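/- Consider $n$ pairs of series $y_{1t}^{(i)}=\mu_1^{(i)}+\beta_1^{(i)}t+u_{1t}^{(i)}$, $y_{2t}^{(i)}=\mu_2^{(i)}+\beta_2^{(i)}t+u_{2t}^{(i)}$, $i=1,\dots,n$, $t=1,\dots,T$. Write $U_t=(u_{1t}^{(1)},\dots,u_{1t}^{(n)},u_{2t}^{(1)},\dots,u_{2t}^{(n)})'$. Let $\hat\theta$ be the vector of IV estimators $$\hat\theta^{(i)}=\Big(\sum_{t=1}^T(t-\bar t)(y_{2t}^{(i)}-\bar y_2^{(i)})\Big)^{-1}\sum_{t=1}^T(t-\bar t)(y_{1t}^{(i)}-\bar y_1^{(i)}),$$ where bars denote sample averages. Assume the functional central limit theorem $$T^{-1/2}\sum_{t=1}^{[rT]}U_t\Rightarrow B_u(r)=\begin{pmatrix}B_{u1}(r)\\B_{u2}(r)\end{pmatrix}=\Lambda_uW_u(r),\qquad r\in[0,1],$$ weakly in $D([0,1],\mathbb R^{2n})$ with the Skorokhod topology, where $\Lambda_u$ is a fixed $2n\times 2n$ matrix and $W_u$ is a vector of $2n$ independent standard Wiener processes. Put $\Omega_u=\Lambda_u\Lambda_u'$.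 For a vector $v$ let $D_v$ be the diagonal matrix with diagonal $v$, and let $D_{B_{u2}}$ be the diagonal matrix with entries $\int_0^1(s-\frac12)\,dB_{u2}^{(i)}(s)$. Let $\bar\beta_1,\bar\beta_2\in\mathbb R^n$ be fixed, with $\bar\beta_2^{(i)}\ne0$ for all $i$. For slopes $\beta_j^{(i)}=T^{-\kappa}\bar\beta_j^{(i)}$ put $\theta^{(i)}=\beta_1^{(i)}/\beta_2^{(i)}=\bar\beta_1^{(i)}/\bar\beta_2^{(i)}$, $\epsilon_{\theta t}=[I_n,-D_\theta]U_t$ and $\Omega_\epsilon=[I_n,-D_\theta]\,\Omega_u\,[I_n,-D_\theta]'$. Let $\Lambda_\epsilon$ be an $n\times n$ matrix with $\Lambda_\epsilon\Lambda_\epsilon'=\Omega_\epsilon$. Then there is a vector $W_\epsilon$ of $n$ independent standard Wiener processes, defined together with $W_u$, such that $[I_n,-D_\theta]B_u(r)=\Lambda_\epsilon W_\epsilon(r)$ for all $r\in[0,1]$ almost surely. For every such $W_\epsilon$ one has $T^{-1/2}\sum_{t=1}^{[rT]}\epsilon_{\theta t}\Rightarrow\Lambda_\epsilon W_\epsilon(r)$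 in $D([0,1],\mathbb R^n)$, and, as $T\to\infty$, Cases 1 and 2 hold. Case 1 (large to small slopes). If $\beta_j^{(i)}=T^{-\kappa}\bar\beta_j^{(i)}$ for $j=1,2$ with $0\le\kappa<\frac32$, then $$T^{3/2-\kappa}(\hat\theta-\theta)\Rightarrow\Big(\tfrac1{12}D_{\bar\beta_2}\Big)^{-1}\Lambda_\epsilon\int_0^1\big(s-\tfrac12\big)dW_\epsilon(s)\sim N\big(0,\,12\,D_{\bar\beta_2}^{-1}\Omega_\epsilon D_{\bar\beta_2}^{-1}\big).$$ Case 2 (very small slopes). If $\beta_j^{(i)}=T^{-3/2}\bar\beta_j^{(i)}$ for $j=1,2$, then $$\hat\theta-\theta\Rightarrow\Big(\tfrac1{12}D_{\bar\beta_2}+D_{B_{u2}}\Big)^{-1}\Lambda_\epsilon\int_0^1\big(s-\tfrac12\big)dW_\epsilon(s).$$ If $(\Omega_\epsilon)_{ii}\neq0$, then the $i$th component of this limit is not almost surely constant, and $\hat\theta^{(i)}-\theta^{(i)}$ does not converge to $0$ in probability. Case 3 (zero slopes). If $\beta_1^{(i)}=\beta_2^{(i)}=0$ for all $i$ and the variance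 of $B_{u2}^{(i)}(1)$ (the corresponding diagonal entry of $\Omega_u$) is nonzero for every $i$, then $$\hat\theta\Rightarrow D_{B_{u2}}^{-1}\int_0^1\big(s-\tfrac12\big)dB_{u1}(s).$$ -/

import Mathlib

open MeasureTheory ProbabilityTheory Filter Topology Set
open scoped NNReal Matrix

noncomputable section

/-! ### The space `D([0,1], E)` with the Skorokhod `J₁` topology -/

/-- A function on `[0,1]` is càdlàg: right-continuous with left limits. (At the endpoint `1` the
first condition is void, at the endpoint `0` the second one is.) -/
def IsCadlag {E : Type*} [TopologicalSpace E] (f : unitInterval → E) : Prop :=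
  ∀ r, ContinuousWithinAt f (Ici r) r ∧ ∃ l, Tendsto f (𝓝[<] r) (𝓝 l)

/-- The space `D([0,1], E)` of càdlàg functions. -/
structure Cadlag (E : Type*) [TopologicalSpace E] where
  toFun : unitInterval → E
  isCadlag : IsCadlag toFun

namespace Cadlag

/-- `y` lies within Skorokhod distance `ε` of `x`: after a strictly increasing continuous change
of time from `[0,1]` onto itself that moves no time by `ε` or more, `y` is uniformly
`ε`-close to `x`. -/
def Near {E : Type*} [PseudoMetricSpace E] (ε : ℝ) (x y : Cadlag E) : Prop :=
  ∃ σ : unitInterval ≃o unitInterval,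
    (∀ r, dist (σ r) r < ε) ∧ ∀ r, dist (x.toFun r) (y.toFun (σ r)) < ε

theorem Near.mono {E : Type*} [PseudoMetricSpace E] {ε δ : ℝ} (h : ε ≤ δ) {x y : Cadlag E}
    (hxy : Near ε x y) : Near δ x y := by
  obtain ⟨σ, h1, h2⟩ := hxy
  exact ⟨σ, fun r => (h1 r).trans_le h, fun r => (h2 r).trans_le h⟩

/-- The Skorokhod `J₁` topology: a set is open if, with each of its points, it contains a
Skorokhod ball around that point. -/
instance {E : Type*} [PseudoMetricSpace E] : TopologicalSpace (Cadlag E) where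
  IsOpen s := ∀ x ∈ s, ∃ ε > 0, ∀ y, Near ε x y → y ∈ s
  isOpen_univ := fun _ _ => ⟨1, one_pos, fun _ _ => mem_univ _⟩
  isOpen_inter := by
    rintro s t hs ht x ⟨hxs, hxt⟩
    obtain ⟨ε, hε, h1⟩ := hs x hxs
    obtain ⟨δ, hδ, h2⟩ := ht x hxt
    exact ⟨min ε δ, lt_min hε hδ, fun y hy =>
      ⟨h1 y (hy.mono (min_le_left _ _)), h2 y (hy.mono (min_le_right _ _))⟩⟩
  isOpen_sUnion := by
    rintro S hS x ⟨s, hs, hxs⟩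
    obtain ⟨ε, hε, h⟩ := hS s hs x hxs
    exact ⟨ε, hε, fun y hy => ⟨s, hs, h y hy⟩⟩

instance {E : Type*} [PseudoMetricSpace E] : MeasurableSpace (Cadlag E) := borel _

instance {E : Type*} [PseudoMetricSpace E] : BorelSpace (Cadlag E) := ⟨rfl⟩

open Classical in
/-- The càdlàg function `f`, as a point of `D([0,1], E)`. It is used for paths that are almost
surely continuous; the exceptional paths are replaced by the zero path. -/
def ofFun {E : Type*} [TopologicalSpace E] [Zero E] (f : unitInterval → E) : Cadlag E :=
  if h : IsCadlag f then ⟨f, h⟩ else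
    ⟨fun _ => 0, fun _ => ⟨continuousWithinAt_const, 0, tendsto_const_nhds⟩⟩

theorem isCadlag_step {E : Type*} [TopologicalSpace E] (T : ℕ) (S : ℕ → E) :
    IsCadlag (fun r : unitInterval => S ⌊(r : ℝ) * T⌋₊) := by
  intro r
  have hr0 : (0 : ℝ) ≤ (r : ℝ) * T := mul_nonneg r.2.1 (Nat.cast_nonneg T)
  have hc : Continuous fun s : unitInterval => (s : ℝ) * T := by fun_prop
  constructor
  · have h1 : ∀ᶠ s : unitInterval in 𝓝[≥] r, S ⌊(s : ℝ) * T⌋₊ = S ⌊(r : ℝ) * T⌋₊ := by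
      have h2 : ∀ᶠ s : unitInterval in 𝓝 r, (s : ℝ) * T < (⌊(r : ℝ) * T⌋₊ : ℝ) + 1 :=
        hc.continuousAt.eventually_lt continuousAt_const (Nat.lt_floor_add_one _)
      filter_upwards [mem_nhdsWithin_of_mem_nhds h2, self_mem_nhdsWithin] with s hs hrs
      have hrs' : (r : ℝ) * T ≤ (s : ℝ) * T :=
        mul_le_mul_of_nonneg_right (Subtype.coe_le_coe.2 hrs) (Nat.cast_nonneg T)
      congr 1
      exact (Nat.floor_eq_iff (hr0.trans hrs')).2 ⟨(Nat.floor_le hr0).trans hrs', hs⟩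
    exact tendsto_nhds_of_eventually_eq h1
  · refine ⟨S (⌈(r : ℝ) * T⌉₊ - 1), tendsto_nhds_of_eventually_eq ?_⟩
    have h2 : ∀ᶠ s : unitInterval in 𝓝 r, (⌈(r : ℝ) * T⌉₊ : ℝ) - 1 < (s : ℝ) * T := by
      refine continuousAt_const.eventually_lt hc.continuousAt ?_
      have := Nat.ceil_lt_add_one hr0
      linarith
    filter_upwards [mem_nhdsWithin_of_mem_nhds h2, self_mem_nhdsWithin] with s hs hsr
    have hs0 : (0 : ℝ) ≤ (s : ℝ) * T := mul_nonneg s.2.1 (Nat.cast_nonneg T)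
    congr 1
    rcases Nat.eq_zero_or_pos T with rfl | hT
    · simp
    have hlt : (s : ℝ) * T < (r : ℝ) * T :=
      mul_lt_mul_of_pos_right (Subtype.coe_lt_coe.2 hsr) (Nat.cast_pos.2 hT)
    have hpos : 1 ≤ ⌈(r : ℝ) * T⌉₊ := Nat.one_le_ceil_iff.2 (hs0.trans_lt hlt)
    refine (Nat.floor_eq_iff hs0).2 ⟨?_, ?_⟩
    · push_cast [Nat.cast_sub hpos]
      exact hs.le
    · push_cast [Nat.cast_sub hpos]
      have := Nat.le_ceil ((r : ℝ) * T)
      linarith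

/-- The step function `r ↦ S_[rT]` on `[0,1]`. -/
def step {E : Type*} [TopologicalSpace E] (T : ℕ) (S : ℕ → E) : Cadlag E :=
  ⟨fun r => S ⌊(r : ℝ) * T⌋₊, isCadlag_step T S⟩

end Cadlag

/-- The partial sum process `r ↦ T^{-1/2} ∑_{t=1}^{[rT]} U_t` on `[0,1]`. -/
def partialSumPath {ι Ω : Type*} (U : ℕ → Ω → ι → ℝ) [Fintype ι] (T : ℕ) (ω : Ω) :
    Cadlag (ι → ℝ) :=
  Cadlag.step T fun m => (T : ℝ) ^ (-(1 / 2) : ℝ) • ∑ t ∈ Finset.Icc 1 m, U t ω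

/-! ### Wiener processes and integrals against their paths -/

/-- `W` is a vector of independent standard Wiener processes. -/
structure IsWienerVector {ι Ω : Type*} [MeasurableSpace Ω] (W : ι → ℝ≥0 → Ω → ℝ)
    (P : Measure Ω) : Prop where
  isBrownian : ∀ j, IsBrownianReal (W j) P
  indep : iIndepFun (fun j ω t => W j t ω) P

/-- The path `r ↦ Λ W(r)`, `r ∈ [0,1]`, of the correlated Brownian motion `Λ W`. -/
def brownianPath {ι κ Ω : Type*} [Fintype κ] (Λ : Matrix ι κ ℝ) (W : κ → ℝ≥0 → Ω → ℝ)
    (ω : Ω) (r : unitInterval) : ι → ℝ :=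
  Λ *ᵥ fun j => W j (unitInterval.toNNReal r) ω

/-- `I` is the Riemann–Stieltjes integral `∫₀¹ f dg`: the sums `∑ f(c_k) (g(t_{k+1}) - g(t_k))`
over tagged partitions of `[0,1]` tend to `I` as the mesh tends to `0`. -/
def HasStieltjesIntegral (f g : unitInterval → ℝ) (I : ℝ) : Prop :=
  ∀ ε > 0, ∃ δ > 0, ∀ (N : ℕ) (t : Fin (N + 1) → unitInterval) (c : Fin N → unitInterval),
    t 0 = 0 → t (Fin.last N) = 1 →
    (∀ k, t k.castSucc ≤ c k ∧ c k ≤ t k.succ ∧ (t k.succ : ℝ) - t k.castSucc < δ) →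
    |∑ k, f (c k) * (g (t k.succ) - g (t k.castSucc)) - I| < ε

open Classical in
/-- The Riemann–Stieltjes integral `∫₀¹ f dg`. It exists if `f` is of bounded variation
and `g` is continuous, whence `∫₀¹ f dB` makes sense path by path for a Brownian motion `B`. -/
def stieltjesIntegral (f g : unitInterval → ℝ) : ℝ :=
  if h : ∃ I, HasStieltjesIntegral f g I then h.choose else 0

/-- The vector `∫₀¹ (s - 1/2) db(s)` for a vector-valued path `b`. -/
def demeanedTrendIntegral {ι : Type*} (b : unitInterval → ι → ℝ) : ι → ℝ :=
  fun i => stieltjesIntegral (fun s => (s : ℝ) - 1 / 2) (fun s => b s i)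

/-! ### Trending series and the IV estimator -/

/-- The series `y_t = μ + β t + u_t` (vectors with one entry per pair). -/
def trendSeries {n : ℕ} {Ω : Type*} (μ β : Fin n → ℝ) (u : ℕ → Ω → Fin n → ℝ)
    (t : ℕ) (ω : Ω) : Fin n → ℝ :=
  fun i => μ i + β i * t + u t ω i

/-- The average `T⁻¹ ∑_{t=1}^T x_t`. -/
def sampleMean (T : ℕ) (x : ℕ → ℝ) : ℝ := (T : ℝ)⁻¹ * ∑ t ∈ Finset.Icc 1 T, x t

/-- `∑_{t=1}^T (t - t̄) (x_t - x̄)`. -/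
def trendCross (T : ℕ) (x : ℕ → ℝ) : ℝ :=
  ∑ t ∈ Finset.Icc 1 T, ((t : ℝ) - sampleMean T fun s => (s : ℝ)) * (x t - sampleMean T x)

/-- The IV estimator of the vector of trend slope ratios, with `t` as instrument. -/
def ivEstimator {n : ℕ} {Ω : Type*} (y₁ y₂ : ℕ → Ω → Fin n → ℝ) (T : ℕ) (ω : Ω) : Fin n → ℝ :=
  fun i => (trendCross T fun t => y₂ t ω i)⁻¹ * trendCross T fun t => y₁ t ω i

/-- The IV estimator from a sample of size `T` of the series with intercepts `μ₁`, `μ₂`, slopes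
`β₁`, `β₂` and noise `U = (U₁, U₂)`. -/
def thetaHat {n : ℕ} {Ω : Type*} (μ₁ μ₂ β₁ β₂ : Fin n → ℝ) (U : ℕ → Ω → Fin n ⊕ Fin n → ℝ)
    (T : ℕ) (ω : Ω) : Fin n → ℝ :=
  ivEstimator (trendSeries μ₁ β₁ fun t ω i => U t ω (Sum.inl i))
    (trendSeries μ₂ β₂ fun t ω i => U t ω (Sum.inr i)) T ω

/-- The slopes `T^{-κ} β̄`. -/
def localSlope {n : ℕ} (κ : ℝ) (βbar : Fin n → ℝ) (T : ℕ) : Fin n → ℝ :=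
  (T : ℝ) ^ (-κ) • βbar

/-- The vector `θ` of slope ratios `β₁ / β₂`. -/
def slopeRatio {n : ℕ} (β₁ β₂ : Fin n → ℝ) : Fin n → ℝ := fun i => β₁ i / β₂ i

/-- Slopes of the form `T^{-κ} β̄` have ratios that do not depend on `T`. -/
theorem slopeRatio_localSlope {n : ℕ} (κ : ℝ) (β₁ β₂ : Fin n → ℝ) {T : ℕ} (hT : 1 ≤ T) :
    slopeRatio (localSlope κ β₁ T) (localSlope κ β₂ T) = slopeRatio β₁ β₂ := by
  have h : (T : ℝ) ^ (-κ) ≠ 0 :=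
    (Real.rpow_pos_of_pos (Nat.cast_pos.2 hT) _).ne'
  funext i
  simp only [slopeRatio, localSlope, Pi.smul_apply, smul_eq_mul]
  exact mul_div_mul_left _ _ h

/-- The estimation error `θ̂ - θ` when the slopes are `T^{-κ} β̄₁`, `T^{-κ} β̄₂`. -/
def ivError {n : ℕ} {Ω : Type*} (μ₁ μ₂ βbar₁ βbar₂ : Fin n → ℝ) (κ : ℝ)
    (U : ℕ → Ω → Fin n ⊕ Fin n → ℝ) (T : ℕ) (ω : Ω) : Fin n → ℝ :=
  thetaHat μ₁ μ₂ (localSlope κ βbar₁ T) (localSlope κ βbar₂ T) U T ω -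
    slopeRatio (localSlope κ βbar₁ T) (localSlope κ βbar₂ T)

/-- The `n × 2n` matrix `[I_n, -D_θ]`. -/
def contrast {n : ℕ} (θ : Fin n → ℝ) : Matrix (Fin n) (Fin n ⊕ Fin n) ℝ :=
  Matrix.fromCols 1 (-Matrix.diagonal θ)

/-- The matrix `Ω_ε = [I_n, -D_θ] Λ_u Λ_u' [I_n, -D_θ]'`. -/
def errorVariance {n : ℕ} (θ : Fin n → ℝ)
    (Λu : Matrix (Fin n ⊕ Fin n) (Fin n ⊕ Fin n) ℝ) : Matrix (Fin n) (Fin n) ℝ :=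
  contrast θ * (Λu * Λuᵀ) * (contrast θ)ᵀ

end

/-! Everything reduces to one functional of the partial sum process `X_T`. Summation by parts gives
`T^{-3/2} ∑ (t - t̄) u_t = X_T(1)/2 - ∫₀¹ X_T - X_T(1)/(2T)` (`trendCross_eq_trendMoment`). The
functional `X ↦ X(1)/2 - ∫₀¹ X` is continuous for the Skorokhod topology
(`Cadlag.continuous_trendMoment`), and on continuous paths starting at `0` it is `∫₀¹ (s - 1/2)
dX(s)` by integration by parts.

Write `z₁`, `z₂` for the normalised noise terms of a pair. Demeaning removes the intercepts, and a
linear trend contributes `T(T² - 1)/12` times its slope. Hence, off the event that the denominator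
vanishes, `T^{3/2-κ}(θ̂ - θ) = (a β̄₂ + δ z₂)⁻¹ (z₁ - θ z₂)` with `a = (1 - T⁻²)/12` and `δ =
T^{κ-3/2}` (`ivError_eq`). Here `a → 1/12`, while `δ → 0` in Case 1 and `δ = 1` in Case 2; Case 3 is
`β̄ = 0`, `δ = 1`. One application of Slutsky and the mapping theorem
(`tendstoInDistribution_ivError`) therefore covers all three cases, provided the limiting
denominator is almost surely nonzero. It is a constant plus a centred Gaussian variable, which
vanishes with positive probability only if the constant and the variance are both zero
(`IsWienerVector.ae_add_ne_zero`).

The process `W_ε` exists because `[I, -D_θ] Λ_u` and `Λ_ε` have the same Gram matrix: the former is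
`Λ_ε Q` with orthonormal rows in `Q`, and `Q W_u` is again a Wiener vector. The normal law comes
from characteristic functions of Riemann–Stieltjes sums. If a component of the Case 2 limit were a
constant `c`, clearing the denominator would make a centred Gaussian variable equal to `c β̄₂/12`;
this forces `c = 0` and then zero error variance. -/

noncomputable section

/-! ### Càdlàg functions -/

section IsCadlag

variable {E : Type*}

theorem Continuous.isCadlag [TopologicalSpace E] {f : unitInterval → E} (hf : Continuous f) :
    IsCadlag f :=
  fun r => ⟨hf.continuousWithinAt, f r, hf.continuousAt.mono_left nhdsWithin_le_nhds⟩

theorem IsCadlag.comp [TopologicalSpace E] {F : Type*} [TopologicalSpace F] {f : unitInterval → E}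
    (hf : IsCadlag f) {g : E → F} (hg : Continuous g) : IsCadlag fun r => g (f r) := fun r =>
  ⟨hg.continuousAt.comp_continuousWithinAt (hf r).1, by
    obtain ⟨l, hl⟩ := (hf r).2
    exact ⟨g l, (hg.tendsto l).comp hl⟩⟩

/-- Off `r`, the values of a càdlàg function near `r` cluster at two points. -/
theorem IsCadlag.exists_isOpen_dist_lt [PseudoMetricSpace E] {f : unitInterval → E}
    (hf : IsCadlag f) (r : unitInterval) {ε : ℝ} (hε : 0 < ε) :
    ∃ l, ∃ u, IsOpen u ∧ r ∈ u ∧ (∀ s ∈ u, r ≤ s → dist (f s) (f r) < ε) ∧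
      ∀ s ∈ u, s < r → dist (f s) l < ε := by
  obtain ⟨h1, l, h2⟩ := hf r
  have h1' := Metric.tendsto_nhds.1 h1 ε hε
  have h2' := Metric.tendsto_nhds.1 h2 ε hε
  rw [eventually_nhdsWithin_iff] at h1' h2'
  obtain ⟨u, hu, huo, hru⟩ := eventually_nhds_iff.1 (h1'.and h2')
  exact ⟨l, u, huo, hru, fun s hs => (hu s hs).1, fun s hs => (hu s hs).2⟩

/-- One-sided limits give local boundedness, and compactness of `[0,1]` makes it global. -/
theorem IsCadlag.isBounded_range [PseudoMetricSpace E] {f : unitInterval → E}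
    (hf : IsCadlag f) : Bornology.IsBounded (range f) := by
  rw [← image_univ]
  refine isCompact_univ.induction_on (p := fun s => Bornology.IsBounded (f '' s)) (by simp)
    (fun s t hst ht => ht.subset (image_mono hst))
    (fun s t hs ht => by rw [image_union]; exact hs.union ht) fun r _ => ?_
  obtain ⟨l, u, huo, hru, h1, h2⟩ := hf.exists_isOpen_dist_lt r one_pos
  refine ⟨u, mem_nhdsWithin_of_mem_nhds (huo.mem_nhds hru), ?_⟩
  refine ((Metric.isBounded_ball (x := f r) (r := 1)).union
    (Metric.isBounded_ball (x := l) (r := 1))).subset ?_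
  rintro _ ⟨s, hs, rfl⟩
  rcases le_or_gt r s with h | h
  · exact Or.inl (h1 s hs h)
  · exact Or.inr (h2 s hs h)

/-- For each `ε` the points with a jump of size at least about `ε` are isolated from each other,
since on either side of any point the values cluster; by compactness they are finite in number. The
discontinuities are the union over `ε = 1/(n+1)`. -/
theorem IsCadlag.countable_not_continuousAt [PseudoMetricSpace E] {f : unitInterval → E}
    (hf : IsCadlag f) : {r | ¬ ContinuousAt f r}.Countable := by
  let D (ε : ℝ) : Set unitInterval := {r | ¬ ∀ᶠ s in 𝓝 r, dist (f s) (f r) < ε + ε}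
  have hD : ∀ ε > 0, (D ε).Finite := by
    intro ε hε
    rw [← inter_univ (D ε)]
    refine isCompact_univ.induction_on (p := fun s => (D ε ∩ s).Finite) (by simp)
      (fun s t hst ht => ht.subset (inter_subset_inter_right _ hst))
      (fun s t hs ht => by rw [inter_union_distrib_left]; exact hs.union ht) fun r _ => ?_
    obtain ⟨l, u, huo, hru, h1, h2⟩ := hf.exists_isOpen_dist_lt r hε
    refine ⟨u, mem_nhdsWithin_of_mem_nhds (huo.mem_nhds hru), (finite_singleton r).subset ?_⟩
    rintro s ⟨hsD, hsu⟩
    by_contra hsr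
    refine hsD ?_
    rcases lt_or_gt_of_ne hsr with h | h
    · filter_upwards [huo.mem_nhds hsu, Iio_mem_nhds h] with t htu htr
      exact (dist_triangle_right _ _ l).trans_lt (add_lt_add (h2 t htu htr) (h2 s hsu h))
    · filter_upwards [huo.mem_nhds hsu, Ioi_mem_nhds h] with t htu htr
      exact (dist_triangle_right _ _ (f r)).trans_lt
        (add_lt_add (h1 t htu (le_of_lt htr)) (h1 s hsu h.le))
  refine (countable_iUnion fun n : ℕ => (hD (1 / ((n : ℝ) + 1))
    Nat.one_div_pos_of_nat).countable).mono ?_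
  intro r hr
  by_contra hr'
  refine hr (Metric.tendsto_nhds.2 fun ε hε => ?_)
  obtain ⟨n, hn⟩ := exists_nat_one_div_lt (half_pos hε)
  have h : ∀ᶠ s in 𝓝 r, dist (f s) (f r) < 1 / ((n : ℝ) + 1) + 1 / ((n : ℝ) + 1) := by
    by_contra h
    exact hr' (mem_iUnion.2 ⟨n, h⟩)
  filter_upwards [h] with s hs
  linarith

theorem IsCadlag.ae_continuousAt [PseudoMetricSpace E] {f : unitInterval → E}
    (hf : IsCadlag f) : ∀ᵐ r, ContinuousAt f r :=
  ae_iff.2 (hf.countable_not_continuousAt.measure_zero _)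

theorem IsCadlag.stronglyMeasurable [PseudoMetricSpace E] [SecondCountableTopology E]
    {f : unitInterval → E} (hf : IsCadlag f) : StronglyMeasurable f :=
  StronglyMeasurable.of_countable_not_continuousAt hf.countable_not_continuousAt

theorem IsCadlag.integrable [NormedAddCommGroup E] [SecondCountableTopology E]
    {f : unitInterval → E} (hf : IsCadlag f) : Integrable f := by
  obtain ⟨M, hM⟩ := hf.isBounded_range.exists_norm_le
  exact Integrable.of_bound hf.stronglyMeasurable.aestronglyMeasurable M
    (ae_of_all _ fun r => hM _ (mem_range_self r))

end IsCadlag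

/-! ### Continuous functionals on Skorokhod space -/

namespace Cadlag

variable {E : Type*}

theorem continuous_of_near [PseudoMetricSpace E] {F : Type*} [PseudoMetricSpace F]
    {f : Cadlag E → F}
    (hf : ∀ x, ∀ η > 0, ∃ ε > 0, ∀ y, Near ε x y → dist (f y) (f x) < η) : Continuous f := by
  refine continuous_def.2 fun s hs x hx => ?_
  obtain ⟨η, hη, h⟩ := Metric.isOpen_iff.1 hs (f x) hx
  obtain ⟨ε, hε, h'⟩ := hf x η hη
  exact ⟨ε, hε, fun y hy => h (h' y hy)⟩

/-- Postcomposition with a continuous function. -/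
def map {F : Type*} [TopologicalSpace E] [TopologicalSpace F] (g : E → F) (hg : Continuous g)
    (x : Cadlag E) : Cadlag F :=
  ⟨fun r => g (x.toFun r), x.isCadlag.comp hg⟩

theorem continuous_map [PseudoMetricSpace E] {F : Type*} [PseudoMetricSpace F] {g : E → F}
    {K : ℝ≥0} (hg : LipschitzWith K g) : Continuous (map g hg.continuous) := by
  refine continuous_def.2 fun s hs x hx => ?_
  obtain ⟨ε, hε, h⟩ := hs _ hx
  have hK : (0 : ℝ) < K + 1 := by positivity
  refine ⟨min ε (ε / (K + 1)), by positivity, fun y hy => h _ ?_⟩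
  obtain ⟨σ, h1, h2⟩ := hy
  refine ⟨σ, fun r => (h1 r).trans_le (min_le_left _ _), fun r => ?_⟩
  calc dist (g (x.toFun r)) (g (y.toFun (σ r))) ≤ K * dist (x.toFun r) (y.toFun (σ r)) :=
        hg.dist_le_mul _ _
    _ ≤ K * (ε / (K + 1)) := by
        gcongr; exact ((h2 r).trans_le (min_le_right _ _)).le
    _ < (K + 1) * (ε / (K + 1)) := by gcongr; linarith
    _ = ε := by field_simp

/-- An increasing bijection of `[0,1]` fixes `1`, so time changes do not affect the value there. -/
theorem continuous_eval_one [PseudoMetricSpace E] :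
    Continuous fun x : Cadlag E => x.toFun 1 := by
  refine continuous_of_near fun x η hη => ⟨η, hη, fun y hy => ?_⟩
  obtain ⟨σ, -, h2⟩ := hy
  have h := h2 1
  rwa [show σ 1 = 1 from σ.map_top, dist_comm] at h

/-- If `yₙ` approaches `x` through time changes `σₙ`, then `yₙ(s)` is close to `x(σₙ⁻¹ s)`, which
tends to `x(s)` at every continuity point of `x`, hence for almost every `s`. Boundedness of `x`
allows dominated convergence. -/
theorem continuous_integral [NormedAddCommGroup E] [NormedSpace ℝ E] [SecondCountableTopology E] :
    Continuous fun x : Cadlag E => ∫ r, x.toFun r := by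
  refine continuous_of_near fun x η hη => ?_
  by_contra! hcon
  choose y hy hyη using fun n : ℕ => hcon (1 / ((n : ℝ) + 1)) Nat.one_div_pos_of_nat
  choose σ hσ hσx using hy
  obtain ⟨M, hM⟩ := x.isCadlag.isBounded_range.exists_norm_le
  have hlim0 : Tendsto (fun n : ℕ => 1 / ((n : ℝ) + 1)) atTop (𝓝 0) :=
    tendsto_one_div_add_atTop_nhds_zero_nat
  have hxy (n : ℕ) (s : unitInterval) :
      dist (x.toFun ((σ n).symm s)) ((y n).toFun s) < 1 / ((n : ℝ) + 1) := by
    simpa using hσx n ((σ n).symm s)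
  have key : Tendsto (fun n => ∫ r, (y n).toFun r) atTop (𝓝 (∫ r, x.toFun r)) := by
    refine tendsto_integral_of_dominated_convergence (fun _ => M + 1)
      (fun n => (y n).isCadlag.stronglyMeasurable.aestronglyMeasurable) (integrable_const _)
      (fun n => ae_of_all _ fun s => ?_) ?_
    · have h1 : ‖(y n).toFun s‖ ≤ ‖x.toFun ((σ n).symm s)‖ +
          ‖x.toFun ((σ n).symm s) - (y n).toFun s‖ := norm_le_norm_add_norm_sub _ _
      have h2 := hM _ (mem_range_self ((σ n).symm s))
      have h3 := hxy n s
      rw [dist_eq_norm] at h3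
      have h4 : 1 / ((n : ℝ) + 1) ≤ 1 := by
        rw [div_le_one (by positivity)]
        linarith [(Nat.cast_nonneg n : (0 : ℝ) ≤ n)]
      linarith
    · filter_upwards [x.isCadlag.ae_continuousAt] with s hs
      have h1 : Tendsto (fun n => (σ n).symm s) atTop (𝓝 s) := by
        refine tendsto_iff_dist_tendsto_zero.2 (squeeze_zero (fun _ => dist_nonneg) (fun n => ?_)
          hlim0)
        have := hσ n ((σ n).symm s)
        rw [OrderIso.apply_symm_apply, dist_comm] at this
        exact this.le
      refine tendsto_of_tendsto_of_dist (hs.tendsto.comp h1)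
        (squeeze_zero (fun _ => dist_nonneg) (fun n => ?_) hlim0)
      exact (hxy n s).le
  obtain ⟨n, hn⟩ := ((Metric.tendsto_nhds.1 key) η hη).exists
  exact absurd hn (not_lt.2 (hyη n))

theorem ofFun_of_isCadlag [TopologicalSpace E] [Zero E] {f : unitInterval → E} (hf : IsCadlag f) :
    ofFun f = ⟨f, hf⟩ := dif_pos hf

end Cadlag

/-! ### Integrals of step functions -/

theorem integral_unitInterval {E : Type*} [NormedAddCommGroup E] [NormedSpace ℝ E] (f : ℝ → E) :
    ∫ r : unitInterval, f r = ∫ r in (0 : ℝ)..1, f r := by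
  rw [intervalIntegral.integral_of_le zero_le_one, ← integral_Icc_eq_integral_Ioc]
  exact integral_subtype measurableSet_Icc f

theorem integral_natFloor {E : Type*} [NormedAddCommGroup E] [NormedSpace ℝ E] [CompleteSpace E]
    (S : ℕ → E) (T : ℕ) :
    ∫ r in (0 : ℝ)..T, S ⌊r⌋₊ = ∑ k ∈ Finset.range T, S k := by
  have hae (k : ℕ) : ∀ᵐ r : ℝ, r ∈ uIoc (k : ℝ) ((k + 1 : ℕ) : ℝ) → S k = S ⌊r⌋₊ := by
    have : ∀ᵐ r : ℝ, r ≠ ((k + 1 : ℕ) : ℝ) := by simp [ae_iff]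
    filter_upwards [this] with r hr hr'
    rw [uIoc_of_le (by simp)] at hr'
    congr 1
    refine ((Nat.floor_eq_iff ((Nat.cast_nonneg k).trans hr'.1.le)).2 ⟨hr'.1.le, ?_⟩).symm
    exact_mod_cast lt_of_le_of_ne hr'.2 hr
  have hint (k : ℕ) :
      IntervalIntegrable (fun r : ℝ => S ⌊r⌋₊) volume (k : ℝ) ((k + 1 : ℕ) : ℝ) :=
    (intervalIntegrable_const (c := S k)).congr_ae
      ((ae_restrict_iff' measurableSet_uIoc).2 (hae k))
  have h := intervalIntegral.sum_integral_adjacent_intervals (μ := volume)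
    (f := fun r : ℝ => S ⌊r⌋₊) (a := fun k : ℕ => (k : ℝ)) (n := T) fun k _ => hint k
  rw [Nat.cast_zero] at h
  rw [← h]
  refine Finset.sum_congr rfl fun k _ => ?_
  rw [← intervalIntegral.integral_congr_ae (hae k)]
  simp

theorem Cadlag.integral_step {E : Type*} [NormedAddCommGroup E] [NormedSpace ℝ E] [CompleteSpace E]
    {T : ℕ} (hT : T ≠ 0) (S : ℕ → E) :
    ∫ r, (Cadlag.step T S).toFun r = (T : ℝ)⁻¹ • ∑ k ∈ Finset.range T, S k := by
  have hT' : (T : ℝ) ≠ 0 := Nat.cast_ne_zero.2 hT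
  rw [← integral_natFloor]
  refine (integral_unitInterval fun r => S ⌊r * T⌋₊).trans ?_
  rw [intervalIntegral.integral_comp_mul_right (fun r => S ⌊r⌋₊) hT']
  simp

/-! ### Convergence in distribution -/

section TendstoInDistribution

variable {ι Ω' E F : Type*} {Ω : ι → Type*} {m : ∀ i, MeasurableSpace (Ω i)}
  {μ : (i : ι) → Measure (Ω i)} [∀ i, IsProbabilityMeasure (μ i)]
  {m' : MeasurableSpace Ω'} {μ' : Measure Ω'} [IsProbabilityMeasure μ'] {l : Filter ι}
  [TopologicalSpace E] [MeasurableSpace E]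

/-- **Mapping theorem**: convergence in distribution is preserved by a measurable map that is
almost surely continuous at the limit. -/
theorem MeasureTheory.TendstoInDistribution.comp_of_ae_continuousAt [HasOuterApproxClosed E]
    [OpensMeasurableSpace E] [TopologicalSpace F] [MeasurableSpace F] [BorelSpace F]
    [HasOuterApproxClosed F] [l.IsCountablyGenerated] {X : (i : ι) → Ω i → E} {Z : Ω' → E}
    (h : TendstoInDistribution X l Z μ μ') {g : E → F} (hg : Measurable g)
    (hc : ∀ᵐ ω ∂μ', ContinuousAt g (Z ω)) :
    TendstoInDistribution (fun i ω => g (X i ω)) l (fun ω => g (Z ω)) μ μ' where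
  forall_aemeasurable i := hg.comp_aemeasurable (h.forall_aemeasurable i)
  aemeasurable_limit := hg.comp_aemeasurable h.aemeasurable_limit
  tendsto := by
    -- Portmanteau: the preimage of a closed `C` need not be closed, but a point of its closure at
    -- which `g` is continuous is still mapped into `C`.
    refine tendsto_of_forall_isClosed_limsup_le' fun C hC => ?_
    have hC' : MeasurableSet (closure (g ⁻¹' C)) := isClosed_closure.measurableSet
    have h1 := ProbabilityMeasure.limsup_measure_closed_le_of_tendsto h.tendsto
      (isClosed_closure (s := g ⁻¹' C))
    simp only [ProbabilityMeasure.coe_mk] at h1 ⊢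
    refine (limsup_le_limsup (Eventually.of_forall fun i => ?_)).trans (h1.trans ?_)
    · rw [Measure.map_apply_of_aemeasurable (f := fun ω => g (X i ω))
        (hg.comp_aemeasurable (h.forall_aemeasurable i)) hC.measurableSet,
        Measure.map_apply_of_aemeasurable (h.forall_aemeasurable i) hC']
      exact measure_mono fun ω hω => subset_closure hω
    · rw [Measure.map_apply_of_aemeasurable (f := fun ω => g (Z ω))
        (hg.comp_aemeasurable h.aemeasurable_limit) hC.measurableSet,
        Measure.map_apply_of_aemeasurable h.aemeasurable_limit hC']
      refine measure_mono_ae ?_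
      filter_upwards [hc] with ω hω hcl
      have := hω.continuousWithinAt.mem_closure_image hcl
      exact hC.closure_subset_iff.2 (image_preimage_subset g C) this

theorem MeasureTheory.TendstoInDistribution.congr_of_eventually [OpensMeasurableSpace E]
    {X Y : (i : ι) → Ω i → E} {Z : Ω' → E}
    (h : TendstoInDistribution X l Z μ μ') (hXY : ∀ᶠ i in l, X i =ᵐ[μ i] Y i)
    (hY : ∀ i, AEMeasurable (Y i) (μ i)) : TendstoInDistribution Y l Z μ μ' where
  forall_aemeasurable := hY
  aemeasurable_limit := h.aemeasurable_limit
  tendsto := by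
    refine h.tendsto.congr' ?_
    filter_upwards [hXY] with i hi
    exact Subtype.ext (Measure.map_congr hi)

end TendstoInDistribution

/-! ### Riemann–Stieltjes integrals -/

/-- The point `k / (N + 1)` of the uniform partition of `[0,1]`. -/
def uniformPartition (N : ℕ) (k : Fin (N + 2)) : unitInterval :=
  ⟨k / (N + 1), by positivity, by
    rw [div_le_one (by positivity)]
    have : (k : ℕ) ≤ N + 1 := Nat.lt_succ_iff.1 k.2
    exact_mod_cast this⟩

theorem HasStieltjesIntegral.tendsto_uniform {f g : unitInterval → ℝ} {I : ℝ}
    (h : HasStieltjesIntegral f g I) :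
    Tendsto (fun N : ℕ => ∑ k : Fin (N + 1), f (uniformPartition N k.castSucc) *
      (g (uniformPartition N k.succ) - g (uniformPartition N k.castSucc))) atTop (𝓝 I) := by
  refine Metric.tendsto_nhds.2 fun ε hε => ?_
  obtain ⟨δ, hδ, hδ'⟩ := h ε hε
  have hlim : Tendsto (fun n : ℕ => 1 / ((n : ℝ) + 1)) atTop (𝓝 0) :=
    tendsto_one_div_add_atTop_nhds_zero_nat
  filter_upwards [hlim.eventually_lt_const hδ] with N hN
  refine hδ' (N + 1) (uniformPartition N) (fun k => uniformPartition N k.castSucc) ?_ ?_ ?_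
  · ext; simp [uniformPartition]
  · ext
    have : ((N : ℝ) + 1) ≠ 0 := by positivity
    simp [uniformPartition, this]
  · intro k
    refine ⟨le_rfl, Subtype.coe_le_coe.1 ?_, ?_⟩
    · simp only [uniformPartition, Fin.val_castSucc, Fin.val_succ, Nat.cast_add, Nat.cast_one]
      gcongr
      linarith
    · simp only [uniformPartition, Fin.val_castSucc, Fin.val_succ, Nat.cast_add, Nat.cast_one]
      rwa [← sub_div, add_sub_cancel_left]

theorem HasStieltjesIntegral.stieltjesIntegral_eq {f g : unitInterval → ℝ} {I : ℝ}
    (h : HasStieltjesIntegral f g I) : stieltjesIntegral f g = I := by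
  have hex : ∃ I, HasStieltjesIntegral f g I := ⟨I, h⟩
  rw [stieltjesIntegral, dif_pos hex]
  exact tendsto_nhds_unique hex.choose_spec.tendsto_uniform h.tendsto_uniform

/-- Integration by parts in `∫₀¹ (s - 1/2) dg(s)`. -/
theorem hasStieltjesIntegral_sub_half {g : unitInterval → ℝ} (hg : Continuous g) :
    HasStieltjesIntegral (fun s => (s : ℝ) - 1 / 2) g ((g 1 + g 0) / 2 - ∫ r, g r) := by
  intro ε hε
  obtain ⟨δ, hδ, hgδ⟩ := Metric.uniformContinuous_iff.1
    (CompactSpace.uniformContinuous_of_continuous hg) (ε / 2) (half_pos hε)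
  refine ⟨δ, hδ, fun N t c ht0 ht1 htc => ?_⟩
  let G : ℝ → ℝ := IccExtend zero_le_one g
  have hG : Continuous G := hg.Icc_extend'
  have hGg (r : unitInterval) : G r = g r := IccExtend_val zero_le_one g r
  have hint : ∫ r, g r = ∑ k : Fin N, ∫ r in (t k.castSucc : ℝ)..(t k.succ : ℝ), G r := by
    have h1 : ∫ r, g r = ∫ r in (0 : ℝ)..1, G r := by
      rw [← integral_unitInterval]
      simp only [hGg]
    let a : ℕ → ℝ := fun k => if h : k < N + 1 then t ⟨k, h⟩ else 0
    have h2 := intervalIntegral.sum_integral_adjacent_intervals (μ := volume) (f := G) (a := a)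
      (n := N) fun k _ => hG.intervalIntegrable _ _
    have ha0 : a 0 = 0 := by
      simp only [a, Nat.zero_lt_succ, dite_true]
      rw [show (⟨0, Nat.succ_pos N⟩ : Fin (N + 1)) = 0 from rfl, ht0]; rfl
    have haN : a N = 1 := by
      simp only [a, Nat.lt_succ_self, dite_true]
      rw [show (⟨N, Nat.lt_succ_self N⟩ : Fin (N + 1)) = Fin.last N from rfl, ht1]; rfl
    rw [h1, ← ha0, ← haN, ← h2, ← Fin.sum_univ_eq_sum_range
      (fun k => ∫ r in a k..a (k + 1), G r)]
    refine Finset.sum_congr rfl fun k _ => ?_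
    have e1 : a k = t k.castSucc := dif_pos (Nat.lt_succ_of_lt k.2)
    have e2 : a (k + 1) = t k.succ := dif_pos (Nat.succ_lt_succ k.2)
    rw [e1, e2]
  have htel (F : unitInterval → ℝ) :
      ∑ k : Fin N, (F (t k.succ) - F (t k.castSucc)) = F 1 - F 0 := by
    rw [← ht1, ← ht0, Finset.sum_sub_distrib]
    have h1 := Fin.sum_univ_succ fun k => F (t k)
    have h2 := Fin.sum_univ_castSucc fun k => F (t k)
    linarith
  -- Summation by parts: in each cell the error is the integral of `g` minus a quadrature using the
  -- endpoint values, weighted by the two lengths into which the tag divides the cell.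
  have hsum : ∑ k, ((c k : ℝ) - 1 / 2) * (g (t k.succ) - g (t k.castSucc)) -
      ((g 1 + g 0) / 2 - ∫ r, g r) =
      ∑ k : Fin N, ((∫ r in (t k.castSucc : ℝ)..(t k.succ : ℝ), G r) -
        (((t k.succ : ℝ) - c k) * g (t k.succ) + ((c k : ℝ) - t k.castSucc) * g (t k.castSucc))) := by
    have h1 := htel fun r => ((r : ℝ) - 1 / 2) * g r
    simp only [Set.Icc.coe_one, Set.Icc.coe_zero] at h1
    have h2 : (g 1 + g 0) / 2 = ∑ k : Fin N, (((t k.succ : ℝ) - 1 / 2) * g (t k.succ) -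
        ((t k.castSucc : ℝ) - 1 / 2) * g (t k.castSucc)) := by rw [h1]; ring
    rw [hint, h2, ← Finset.sum_sub_distrib, ← Finset.sum_sub_distrib]
    refine Finset.sum_congr rfl fun k _ => ?_
    ring
  have hterm (k : Fin N) : |(∫ r in (t k.castSucc : ℝ)..(t k.succ : ℝ), G r) -
      (((t k.succ : ℝ) - c k) * g (t k.succ) + ((c k : ℝ) - t k.castSucc) * g (t k.castSucc))| ≤
      ε / 2 * ((t k.succ : ℝ) - t k.castSucc) := by
    obtain ⟨h1, h2, h3⟩ := htc k
    have h1' : (t k.castSucc : ℝ) ≤ c k := h1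
    have h2' : (c k : ℝ) ≤ t k.succ := h2
    have hclose (u v : ℝ) (hu : u ∈ Icc (t k.castSucc : ℝ) (t k.succ))
        (hv : v ∈ Icc (t k.castSucc : ℝ) (t k.succ)) : |G u - G v| ≤ ε / 2 := by
      have hu' : u ∈ Icc (0 : ℝ) 1 := ⟨(t k.castSucc).2.1.trans hu.1, hu.2.trans (t k.succ).2.2⟩
      have hv' : v ∈ Icc (0 : ℝ) 1 := ⟨(t k.castSucc).2.1.trans hv.1, hv.2.trans (t k.succ).2.2⟩
      have e1 : G u = g ⟨u, hu'⟩ := IccExtend_of_mem zero_le_one g hu'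
      have e2 : G v = g ⟨v, hv'⟩ := IccExtend_of_mem zero_le_one g hv'
      rw [e1, e2, ← Real.dist_eq]
      refine (hgδ ?_).le
      rw [Subtype.dist_eq, Real.dist_eq, abs_lt]
      constructor <;> linarith [hu.1, hu.2, hv.1, hv.2]
    -- Cutting the cell at its tag compares `g` with the left endpoint value on one piece and with
    -- the right one on the other; uniform continuity bounds both differences.
    have hsplit : (∫ r in (t k.castSucc : ℝ)..(t k.succ : ℝ), G r) -
        (((t k.succ : ℝ) - c k) * g (t k.succ) + ((c k : ℝ) - t k.castSucc) * g (t k.castSucc)) =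
        (∫ r in (t k.castSucc : ℝ)..(c k : ℝ), (G r - G (t k.castSucc))) +
        ∫ r in (c k : ℝ)..(t k.succ : ℝ), (G r - G (t k.succ)) := by
      rw [intervalIntegral.integral_sub (hG.intervalIntegrable _ _) (by simp),
        intervalIntegral.integral_sub (hG.intervalIntegrable _ _) (by simp),
        ← intervalIntegral.integral_add_adjacent_intervals
          (hG.intervalIntegrable (t k.castSucc : ℝ) (c k)) (hG.intervalIntegrable _ _)]
      simp only [intervalIntegral.integral_const, smul_eq_mul, hGg]
      ring
    rw [hsplit]
    have b1 : ‖∫ r in (t k.castSucc : ℝ)..(c k : ℝ), (G r - G (t k.castSucc))‖ ≤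
        ε / 2 * |(c k : ℝ) - t k.castSucc| :=
      intervalIntegral.norm_integral_le_of_norm_le_const fun r hr => by
        rw [uIoc_of_le h1'] at hr
        exact hclose _ _ ⟨hr.1.le, hr.2.trans h2'⟩ ⟨le_rfl, h1'.trans h2'⟩
    have b2 : ‖∫ r in (c k : ℝ)..(t k.succ : ℝ), (G r - G (t k.succ))‖ ≤
        ε / 2 * |(t k.succ : ℝ) - c k| :=
      intervalIntegral.norm_integral_le_of_norm_le_const fun r hr => by
        rw [uIoc_of_le h2'] at hr
        exact hclose _ _ ⟨h1'.trans hr.1.le, hr.2⟩ ⟨h1'.trans h2', le_rfl⟩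
    rw [abs_of_nonneg (by linarith)] at b1 b2
    calc _ ≤ _ := abs_add_le _ _
      _ ≤ ε / 2 * ((c k : ℝ) - t k.castSucc) + ε / 2 * ((t k.succ : ℝ) - c k) := add_le_add b1 b2
      _ = _ := by ring
  have htot := htel fun r => (r : ℝ)
  simp only [Set.Icc.coe_one, Set.Icc.coe_zero] at htot
  rw [hsum]
  calc _ ≤ ∑ k : Fin N, ε / 2 * ((t k.succ : ℝ) - t k.castSucc) :=
        (Finset.abs_sum_le_sum_abs _ _).trans (Finset.sum_le_sum fun k _ => hterm k)
    _ = ε / 2 := by rw [← Finset.mul_sum, htot]; ring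
    _ < ε := half_lt_self hε

theorem stieltjesIntegral_sub_half {g : unitInterval → ℝ} (hg : Continuous g) :
    stieltjesIntegral (fun s => (s : ℝ) - 1 / 2) g = (g 1 + g 0) / 2 - ∫ r, g r :=
  (hasStieltjesIntegral_sub_half hg).stieltjesIntegral_eq

theorem demeanedTrendIntegral_eq {ι : Type*} [Fintype ι] {b : unitInterval → ι → ℝ}
    (hb : Continuous b) : demeanedTrendIntegral b = (1 / 2 : ℝ) • (b 1 + b 0) - ∫ r, b r := by
  funext i
  have hbi : Continuous fun r => b r i := (continuous_apply i).comp hb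
  rw [demeanedTrendIntegral, stieltjesIntegral_sub_half hbi, Pi.sub_apply,
    eval_integral (f := b) fun j => ((continuous_apply j).comp hb).isCadlag.integrable]
  simp only [Pi.smul_apply, Pi.add_apply, smul_eq_mul]
  ring

theorem demeanedTrendIntegral_mulVec {ι κ : Type*} [Fintype ι] [Fintype κ] (A : Matrix ι κ ℝ)
    {b : unitInterval → κ → ℝ} (hb : Continuous b) :
    demeanedTrendIntegral (fun r => A *ᵥ b r) = A *ᵥ demeanedTrendIntegral b := by
  have hA : Continuous fun r => A *ᵥ b r := continuous_const.matrix_mulVec hb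
  have hint : ∫ r, A *ᵥ b r = A *ᵥ ∫ r, b r :=
    A.mulVecLin.toContinuousLinearMap.integral_comp_comm hb.isCadlag.integrable
  rw [demeanedTrendIntegral_eq hA, demeanedTrendIntegral_eq hb, hint, Matrix.mulVec_sub,
    Matrix.mulVec_smul, Matrix.mulVec_add]

/-! ### The integral `∫₀¹ (s - 1/2) dB(s)` along a Brownian motion -/

theorem sum_range_sub_sq (a : ℝ) (n : ℕ) :
    ∑ k ∈ Finset.range n, ((k : ℝ) - a) ^ 2 =
      n * (n - 1) * (2 * n - 1) / 6 - a * n * (n - 1) + n * a ^ 2 := by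
  induction n with
  | zero => simp
  | succ n ih => rw [Finset.sum_range_succ, ih]; push_cast; ring

/-- This is the variance of `trendSum B N`: a Riemann sum of `∫₀¹ (s - 1/2)² ds = 1/12`, with its
exact error. -/
theorem sum_uniformPartition_sub_half_sq (N : ℕ) :
    ∑ k : Fin (N + 1), ((uniformPartition N k.castSucc : ℝ) - 1 / 2) ^ 2 * (1 / ((N : ℝ) + 1)) =
      1 / 12 + 1 / 6 * (1 / ((N : ℝ) + 1)) ^ 2 := by
  have hN : (N : ℝ) + 1 ≠ 0 := by positivity
  have h := sum_range_sub_sq (((N : ℝ) + 1) / 2) (N + 1)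
  rw [← Fin.sum_univ_eq_sum_range (fun k => ((k : ℝ) - ((N : ℝ) + 1) / 2) ^ 2)] at h
  have h1 (k : Fin (N + 1)) :
      ((uniformPartition N k.castSucc : ℝ) - 1 / 2) ^ 2 * (1 / ((N : ℝ) + 1)) =
      ((k : ℝ) - ((N : ℝ) + 1) / 2) ^ 2 * (1 / ((N : ℝ) + 1) ^ 3) := by
    simp only [uniformPartition, Fin.val_castSucc]
    field_simp
  rw [Finset.sum_congr rfl fun k _ => h1 k, ← Finset.sum_mul, h]
  push_cast
  field_simp
  ring

section Brownian

variable {Ω : Type*} [MeasurableSpace Ω] {P : Measure Ω} {B : ℝ≥0 → Ω → ℝ}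

/-- The integral `∫₀¹ (s - 1/2) dB(s)`. -/
def trendIntegral (B : ℝ≥0 → Ω → ℝ) (ω : Ω) : ℝ :=
  stieltjesIntegral (fun s => (s : ℝ) - 1 / 2) fun r => B (unitInterval.toNNReal r) ω

/-- The Riemann–Stieltjes sums of `∫₀¹ (s - 1/2) dB(s)` over uniform partitions. -/
def trendSum (B : ℝ≥0 → Ω → ℝ) (N : ℕ) (ω : Ω) : ℝ :=
  ∑ k : Fin (N + 1), ((uniformPartition N k.castSucc : ℝ) - 1 / 2) *
    (B (unitInterval.toNNReal (uniformPartition N k.succ)) ω -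
      B (unitInterval.toNNReal (uniformPartition N k.castSucc)) ω)

namespace ProbabilityTheory

/-- The increments are independent centred Gaussians of variance `1/(N+1)`, so the characteristic
function of the weighted sum is a product of exponentials and the variances add up. -/
theorem IsPreBrownianReal.charFun_trendSum (hB : IsPreBrownianReal B P) (N : ℕ) (t : ℝ) :
    charFun (P.map (trendSum B N)) t =
      Complex.exp (-((1 / 12 + 1 / 6 * (1 / ((N : ℝ) + 1)) ^ 2 : ℝ) : ℂ) * t ^ 2 / 2) := by
  have hmono : Monotone fun k => unitInterval.toNNReal (uniformPartition N k) := by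
    intro j k hjk
    rw [← NNReal.coe_le_coe]
    simp only [unitInterval.coe_toNNReal, uniformPartition]
    gcongr
    exact hjk
  have hind := hB.hasIndepIncrements (N + 1) _ hmono
  have hmeas (k : Fin (N + 1)) : AEMeasurable (fun ω =>
      B (unitInterval.toNNReal (uniformPartition N k.succ)) ω -
      B (unitInterval.toNNReal (uniformPartition N k.castSucc)) ω) P :=
    (hB.aemeasurable _).sub (hB.aemeasurable _)
  have hind' := hind.comp
    (fun k x => ((uniformPartition N k.castSucc : ℝ) - 1 / 2) * x) fun k => measurable_const_mul _
  have hprod := hind'.charFun_map_fun_sum_eq_prod fun k => (hmeas k).const_mul _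
  have hsum := sum_uniformPartition_sub_half_sq N
  change charFun (P.map fun ω => ∑ k : Fin (N + 1), _) t = _
  refine (congrFun hprod t).trans ?_
  rw [Finset.prod_apply, ← hsum]
  have hk (k : Fin (N + 1)) : charFun (P.map fun ω => ((uniformPartition N k.castSucc : ℝ) - 1 / 2) *
      (B (unitInterval.toNNReal (uniformPartition N k.succ)) ω -
        B (unitInterval.toNNReal (uniformPartition N k.castSucc)) ω)) t =
      Complex.exp (-((((uniformPartition N k.castSucc : ℝ) - 1 / 2) ^ 2 *
        (1 / ((N : ℝ) + 1)) : ℝ) : ℂ) * t ^ 2 / 2) := by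
    have h1 := charFun_map_mul_comp (hmeas k) ((uniformPartition N k.castSucc : ℝ) - 1 / 2) t
    refine h1.trans ?_
    have h2 := (hB.hasLaw_sub (unitInterval.toNNReal (uniformPartition N k.succ))
      (unitInterval.toNNReal (uniformPartition N k.castSucc))).map_eq
    have h3 : ((nndist (unitInterval.toNNReal (uniformPartition N k.succ)).1
        (unitInterval.toNNReal (uniformPartition N k.castSucc)).1 : ℝ≥0) : ℝ) =
        1 / ((N : ℝ) + 1) := by
      rw [coe_nndist, Real.dist_eq]
      change |((uniformPartition N k.succ : unitInterval) : ℝ) -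
        ((uniformPartition N k.castSucc : unitInterval) : ℝ)| = 1 / ((N : ℝ) + 1)
      simp only [uniformPartition, Fin.val_castSucc, Fin.val_succ, Nat.cast_add, Nat.cast_one]
      rw [← sub_div, add_sub_cancel_left, abs_of_pos (by positivity)]
    refine (congrFun (congrArg charFun h2) _).trans ?_
    rw [charFun_gaussianReal, ← h3]
    congr 1
    push_cast
    ring
  rw [Finset.prod_congr rfl fun k _ => hk k, ← Complex.exp_sum]
  congr 1
  rw [← Finset.sum_div, ← Finset.sum_mul, Finset.sum_neg_distrib, Complex.ofReal_sum]

theorem IsBrownianReal.ae_continuous_toNNReal (hB : IsBrownianReal B P) :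
    ∀ᵐ ω ∂P, Continuous fun r => B (unitInterval.toNNReal r) ω :=
  hB.cont.mono fun _ h => h.comp unitInterval.toNNReal_continuous

theorem IsBrownianReal.tendsto_trendSum (hB : IsBrownianReal B P) :
    ∀ᵐ ω ∂P, Tendsto (fun N => trendSum B N ω) atTop (𝓝 (trendIntegral B ω)) := by
  filter_upwards [hB.ae_continuous_toNNReal] with ω hω
  have h := hasStieltjesIntegral_sub_half hω
  rw [trendIntegral, h.stieltjesIntegral_eq]
  exact h.tendsto_uniform

theorem IsPreBrownianReal.aemeasurable_trendSum (hB : IsPreBrownianReal B P) (N : ℕ) :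
    AEMeasurable (trendSum B N) P :=
  Finset.aemeasurable_fun_sum _ fun _ _ =>
    ((hB.aemeasurable _).sub (hB.aemeasurable _)).const_mul _

theorem IsBrownianReal.aemeasurable_trendIntegral (hB : IsBrownianReal B P) :
    AEMeasurable (trendIntegral B) P :=
  aemeasurable_of_tendsto_metrizable_ae atTop hB.aemeasurable_trendSum hB.tendsto_trendSum

/-- `∫₀¹ (s - 1/2) dB(s)` is `N(0, 1/12)`. -/
theorem IsBrownianReal.hasLaw_trendIntegral (hB : IsBrownianReal B P) :
    HasLaw (trendIntegral B) (gaussianReal 0 (1 / 12)) P where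
  aemeasurable := hB.aemeasurable_trendIntegral
  map_eq := by
    have : IsProbabilityMeasure P := hB.isGaussianProcess.isProbabilityMeasure
    have : IsProbabilityMeasure (P.map (trendIntegral B)) :=
      Measure.isProbabilityMeasure_map hB.aemeasurable_trendIntegral
    -- The sums converge almost surely, so their characteristic functions converge by dominated
    -- convergence; their variances tend to `1/12`.
    refine Measure.ext_of_charFun (funext fun t => ?_)
    have h1 : Tendsto (fun N => charFun (P.map (trendSum B N)) t) atTop
        (𝓝 (charFun (P.map (trendIntegral B)) t)) := by
      simp only [charFun_apply_real]
      rw [integral_map hB.aemeasurable_trendIntegral (by fun_prop)]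
      have h (N : ℕ) := integral_map (hB.aemeasurable_trendSum N)
        (f := fun x : ℝ => Complex.exp (t * x * Complex.I)) (by fun_prop)
      simp only [h]
      refine tendsto_integral_of_dominated_convergence (fun _ => 1) (fun N => ?_)
        (integrable_const _) (fun N => ae_of_all _ fun ω => ?_) ?_
      · have := hB.aemeasurable_trendSum N
        exact AEMeasurable.aestronglyMeasurable (by fun_prop)
      · rw [← Complex.ofReal_mul, Complex.norm_exp_ofReal_mul_I]
      · filter_upwards [hB.tendsto_trendSum] with ω hω
        have hc : Continuous fun x : ℝ => Complex.exp (t * x * Complex.I) := by fun_prop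
        exact (hc.tendsto _).comp hω
    refine tendsto_nhds_unique h1 ?_
    simp only [hB.charFun_trendSum, charFun_gaussianReal]
    have hlim : Tendsto (fun N : ℕ => (1 / 12 + 1 / 6 * (1 / ((N : ℝ) + 1)) ^ 2 : ℝ)) atTop
        (𝓝 (1 / 12 + 1 / 6 * 0 ^ 2)) :=
      ((tendsto_one_div_add_atTop_nhds_zero_nat.pow 2).const_mul _).const_add _
    have hc : Continuous fun x : ℝ => Complex.exp (-(x : ℂ) * t ^ 2 / 2) := by fun_prop
    convert (hc.tendsto _).comp hlim using 2
    congr 1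
    simp only [Complex.ofReal_zero, mul_zero, zero_mul, zero_sub]
    push_cast
    norm_num
    ring_nf

end ProbabilityTheory

end Brownian

/-! ### Rotations of Wiener vectors -/

section Wiener

variable {Ω ι κ : Type*} [MeasurableSpace Ω] {P : Measure Ω} {W : κ → ℝ≥0 → Ω → ℝ}

namespace IsWienerVector

/-- Independent Gaussian vectors are jointly Gaussian. A finite set of index pairs lies in `κ × J`
with `J` its set of times, so its family is a linear image of the joint vector. -/
theorem isGaussianProcess [Fintype κ] (hW : IsWienerVector W P) :
    IsGaussianProcess (fun p : (_ : κ) × ℝ≥0 => W p.1 p.2) P where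
  hasGaussianLaw I := by
    classical
    let J : Finset ℝ≥0 := I.image Sigma.snd
    have h1 : HasGaussianLaw (fun ω (j : κ) => J.restrict (W j · ω)) P := by
      refine iIndepFun.hasGaussianLaw (X := fun j ω => J.restrict (W j · ω))
        (fun j => (IsPreBrownianReal.isGaussianProcess <|
          (hW.isBrownian j).toIsPreBrownianReal).hasGaussianLaw J) ?_
      exact hW.indep.comp (fun _ x => J.restrict x) fun _ => by fun_prop
    let L : (κ → J → ℝ) →L[ℝ] (I → ℝ) :=
      ContinuousLinearMap.pi fun p =>
        (ContinuousLinearMap.proj (R := ℝ) (φ := fun _ : J => ℝ)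
          ⟨p.1.2, Finset.mem_image_of_mem _ p.2⟩).comp
          (ContinuousLinearMap.proj (R := ℝ) (φ := fun _ : κ => J → ℝ) p.1.1)
    exact h1.map L

theorem memLp_two (hW : IsWienerVector W P) (j : κ) (t : ℝ≥0) : MemLp (W j t) 2 P :=
  have hG := IsPreBrownianReal.isGaussianProcess <| (hW.isBrownian j).toIsPreBrownianReal
  (hG.hasGaussianLaw_eval t).memLp_two

theorem covariance_eval [DecidableEq κ] [IsProbabilityMeasure P] (hW : IsWienerVector W P)
    (j k : κ) (s t : ℝ≥0) :
    cov[W j s, W k t; P] = if j = k then ((min s t : ℝ≥0) : ℝ) else 0 := by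
  split_ifs with h
  · subst h
    rw [(hW.isBrownian j).covariance_eval]
  · have hind := (hW.indep.indepFun h).comp (measurable_pi_apply s) (measurable_pi_apply t)
    exact hind.covariance_eq_zero (hW.memLp_two j s) (hW.memLp_two k t)

/-- Rows of `Q` orthonormal: `Q W` is again a vector of independent Wiener processes. -/
theorem rotate [Fintype κ] [DecidableEq ι] [IsProbabilityMeasure P] (hW : IsWienerVector W P)
    {Q : Matrix ι κ ℝ} (hQ : Q * Qᵀ = 1) :
    IsWienerVector (fun i t ω => ∑ k, Q i k * W k t ω) P := by
  classical
  have hG : IsGaussianProcess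
      (fun (p : (_ : ι) × ℝ≥0) ω => ∑ k, Q p.1 k * W k p.2 ω) P := by
    refine hW.isGaussianProcess.of_isGaussianProcess fun p =>
      ⟨Finset.univ.image fun k => (⟨k, p.2⟩ : (_ : κ) × ℝ≥0),
        ∑ k, Q p.1 k • ContinuousLinearMap.proj
          ⟨⟨k, p.2⟩, Finset.mem_image_of_mem _ (Finset.mem_univ k)⟩, fun ω => ?_⟩
    simp
  have hm (i : ι) (t : ℝ≥0) (k : κ) : MemLp (fun ω => Q i k * W k t ω) 2 P :=
    (hW.memLp_two k t).const_mul _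
  have hcov (i j : ι) (s t : ℝ≥0) :
      cov[fun ω => ∑ k, Q i k * W k s ω, fun ω => ∑ k, Q j k * W k t ω; P] =
        if i = j then ((min s t : ℝ≥0) : ℝ) else 0 := by
    rw [covariance_fun_sum_fun_sum (fun k => hm i s k) (fun k => hm j t k)]
    have h1 (k l : κ) : cov[fun ω => Q i k * W k s ω, fun ω => Q j l * W l t ω; P] =
        if k = l then Q i k * Q j l * ((min s t : ℝ≥0) : ℝ) else 0 := by
      rw [covariance_const_mul_left, covariance_const_mul_right, hW.covariance_eval]
      split_ifs <;> ring
    simp only [h1, Finset.sum_ite_eq, Finset.mem_univ, if_true]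
    rw [← Finset.sum_mul]
    have h2 := congrFun (congrFun hQ i) j
    rw [Matrix.mul_apply, Matrix.one_apply] at h2
    simp only [Matrix.transpose_apply] at h2
    rw [h2]
    split_ifs <;> simp
  refine ⟨fun i => ⟨IsGaussianProcess.isPreBrownianReal_of_covariance
    (hG.comp_right fun t => (⟨i, t⟩ : (_ : ι) × ℝ≥0)) (fun t => ?_) (fun s t hst => ?_), ?_⟩, ?_⟩
  · rw [integral_finsetSum _ fun k _ => (hm i t k).integrable one_le_two]
    refine Finset.sum_eq_zero fun k _ => ?_
    rw [integral_const_mul, (hW.isBrownian k).integral_eval, mul_zero]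
  · rw [hcov, if_pos rfl, min_eq_left hst]
  · filter_upwards [ae_all_iff.2 fun k => (hW.isBrownian k).cont] with ω hω
    exact continuous_finsetSum _ fun k _ => continuous_const.mul (hω k)
  -- Within one Gaussian process, uncorrelated families are independent; orthogonality of the rows
  -- makes the cross-covariances vanish.
  · refine IsGaussianProcess.iIndepFun_of_covariance_eq_zero (S := fun _ : ι => ℝ≥0)
      (X := fun i t ω => ∑ k, Q i k * W k t ω) hG (fun i t => hG.aemeasurable ⟨i, t⟩)
      fun i j hij s t => ?_
    rw [hcov, if_neg hij]

end IsWienerVector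

end Wiener

/-! ### Square roots of a matrix differ by an orthogonal matrix -/

/-- Equal norms make `f x ↦ g x` a well-defined isometry on the range of `f`; in finite dimension it
extends to all of `V`. -/
theorem LinearMap.exists_linearIsometry_comp_eq {E V : Type*} [AddCommGroup E] [Module ℝ E]
    [NormedAddCommGroup V] [InnerProductSpace ℝ V] [FiniteDimensional ℝ V] (f g : E →ₗ[ℝ] V)
    (h : ∀ x, ‖f x‖ = ‖g x‖) : ∃ L : V →ₗᵢ[ℝ] V, ∀ x, L (f x) = g x := by
  obtain ⟨s, hs⟩ := f.rangeRestrict.exists_rightInverse_of_surjective f.range_rangeRestrict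
  have hs' (y : LinearMap.range f) : f (s y) = y :=
    congrArg Subtype.val (LinearMap.congr_fun hs y)
  let L₀ : LinearMap.range f →ₗᵢ[ℝ] V :=
    ⟨g ∘ₗ s, fun y => by
      rw [LinearMap.comp_apply, ← h, hs']; rfl⟩
  refine ⟨L₀.extend, fun x => ?_⟩
  have h1 : L₀.extend (f x) = L₀ ⟨f x, LinearMap.mem_range_self f x⟩ :=
    L₀.extend_apply ⟨f x, LinearMap.mem_range_self f x⟩
  rw [h1]
  change g (s ⟨f x, _⟩) = g x
  rw [← sub_eq_zero, ← map_sub, ← norm_eq_zero, ← h, map_sub, hs', sub_self, norm_zero]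

/-- Equal Gram matrices mean `‖Bᵀx‖ = ‖Aᵀx‖` for all `x`, so an isometry carries each `Bᵀx` to
`Aᵀx`. No invertibility is needed. -/
theorem Matrix.exists_orthogonal_mul_eq {ι κ : Type*} [Fintype ι] [Fintype κ] [DecidableEq κ]
    (A B : Matrix ι κ ℝ) (h : B * Bᵀ = A * Aᵀ) :
    ∃ R : Matrix κ κ ℝ, R * Rᵀ = 1 ∧ A = B * R := by
  let toE (C : Matrix ι κ ℝ) : (ι → ℝ) →ₗ[ℝ] EuclideanSpace ℝ κ :=
    (WithLp.linearEquiv 2 ℝ (κ → ℝ)).symm.toLinearMap ∘ₗ Cᵀ.mulVecLin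
  have hnorm (C : Matrix ι κ ℝ) (x : ι → ℝ) : ‖toE C x‖ ^ 2 = x ⬝ᵥ (C * Cᵀ) *ᵥ x := by
    rw [EuclideanSpace.real_norm_sq_eq, ← Matrix.mulVec_mulVec, Matrix.dotProduct_mulVec,
      ← Matrix.mulVec_transpose]
    exact Finset.sum_congr rfl fun k _ => sq _
  obtain ⟨L, hL⟩ := (toE B).exists_linearIsometry_comp_eq (toE A) fun x => by
    rw [← sq_eq_sq₀ (norm_nonneg _) (norm_nonneg _), hnorm, hnorm, h]
  -- The rows of `R` are the images of the basis vectors, so that `L` acts on row vectors by `v ↦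
  -- vR`, and hence sends the rows of `B` to those of `A`.
  let R : Matrix κ κ ℝ := Matrix.of fun i k => L (EuclideanSpace.single i 1) k
  have hR (v : EuclideanSpace ℝ κ) (k : κ) : L v k = ∑ i, v i * R i k := by
    have h1 : v = ∑ i, v i • EuclideanSpace.single i (1 : ℝ) := by
      ext k
      simp [Pi.single_apply]
    conv_lhs => rw [h1]
    simp [R, map_sum]
  refine ⟨R, ?_, ?_⟩
  · ext i j
    have h1 := L.inner_map_map (EuclideanSpace.single j (1 : ℝ)) (EuclideanSpace.single i 1)
    rw [PiLp.inner_apply] at h1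
    rw [Matrix.mul_apply, Matrix.one_apply]
    simp only [Matrix.transpose_apply, R, Matrix.of_apply]
    refine Eq.trans (Finset.sum_congr rfl fun k _ => ?_) (h1.trans ?_)
    · simp
    · simp [EuclideanSpace.inner_single_left, PiLp.single_apply, eq_comm]
  · ext i k
    classical
    have h1 := congrArg (fun v : EuclideanSpace ℝ κ => v k) (hL (Pi.single i 1))
    simp only [hR] at h1
    rw [Matrix.mul_apply]
    have h2 (C : Matrix ι κ ℝ) (l : κ) : toE C (Pi.single i 1) l = C i l := by
      change (Cᵀ *ᵥ Pi.single i 1) l = C i l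
      simp
    simp only [h2] at h1
    exact h1.symm

/-- Padding `Λ` with zero columns gives it the shape of `A`. The resulting orthogonal matrix matters
only through its top rows, which form `Q`. -/
theorem Matrix.exists_rows_orthonormal_mul_eq {ι ι' : Type*} [Fintype ι] [DecidableEq ι]
    [Fintype ι'] [DecidableEq ι'] (A : Matrix ι (ι ⊕ ι') ℝ) (Λ : Matrix ι ι ℝ)
    (h : Λ * Λᵀ = A * Aᵀ) : ∃ Q : Matrix ι (ι ⊕ ι') ℝ, Q * Qᵀ = 1 ∧ A = Λ * Q := by
  obtain ⟨R, hR, hA⟩ := Matrix.exists_orthogonal_mul_eq A (Matrix.fromCols Λ 0) (by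
    rw [Matrix.transpose_fromCols, Matrix.fromCols_mul_fromRows, h]; simp)
  refine ⟨R.toRows₁, ?_, ?_⟩
  · ext i j
    have h1 := congrFun (congrFun hR (Sum.inl i)) (Sum.inl j)
    rw [Matrix.mul_apply, Matrix.one_apply] at h1 ⊢
    simpa using h1
  · conv_lhs => rw [hA, ← R.fromRows_toRows, Matrix.fromCols_mul_fromRows]
    simp

/-! ### Integrals along correlated Brownian motions -/

theorem demeanedTrendIntegral_brownianPath_one {Ω κ : Type*} [Fintype κ] [DecidableEq κ]
    {W : κ → ℝ≥0 → Ω → ℝ} (ω : Ω) :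
    demeanedTrendIntegral (brownianPath 1 W ω) = fun k => trendIntegral (W k) ω := by
  funext k
  simp [demeanedTrendIntegral, brownianPath, trendIntegral]

section Wiener

variable {Ω ι κ : Type*} [MeasurableSpace Ω] {P : Measure Ω} {W : κ → ℝ≥0 → Ω → ℝ}

namespace IsWienerVector

theorem aemeasurable_trendIntegral (hW : IsWienerVector W P) (k : κ) :
    AEMeasurable (trendIntegral (W k)) P :=
  (hW.isBrownian k).aemeasurable_trendIntegral

variable [Fintype κ]


theorem ae_continuous_brownianPath (hW : IsWienerVector W P) :
    ∀ᵐ ω ∂P, ∀ Λ : Matrix ι κ ℝ, Continuous (brownianPath Λ W ω) := by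
  filter_upwards [ae_all_iff.2 fun k => (hW.isBrownian k).ae_continuous_toNNReal] with ω hω Λ
  exact continuous_const.matrix_mulVec (continuous_pi hω)

theorem ae_brownianPath_zero (hW : IsWienerVector W P) :
    ∀ᵐ ω ∂P, ∀ Λ : Matrix ι κ ℝ, brownianPath Λ W ω 0 = 0 := by
  filter_upwards [ae_all_iff.2 fun k => (hW.isBrownian k).eval_zero_ae_eq_zero] with ω hω Λ
  have : (fun k => W k (unitInterval.toNNReal 0) ω) = 0 := funext hω
  rw [brownianPath, this, Matrix.mulVec_zero]

theorem ae_demeanedTrendIntegral_brownianPath [Fintype ι] (hW : IsWienerVector W P) :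
    ∀ᵐ ω ∂P, ∀ Λ : Matrix ι κ ℝ, demeanedTrendIntegral (brownianPath Λ W ω) =
      Λ *ᵥ fun k => trendIntegral (W k) ω := by
  classical
  filter_upwards [hW.ae_continuous_brownianPath (ι := κ)] with ω hω Λ
  rw [← demeanedTrendIntegral_brownianPath_one, ← demeanedTrendIntegral_mulVec Λ (hω 1)]
  congr 1
  funext r
  simp [brownianPath]

/-- A linear combination of `∫₀¹ (s - 1/2) dW_k(s)` is centred Gaussian. -/
theorem hasLaw_sum_trendIntegral [IsProbabilityMeasure P] (hW : IsWienerVector W P)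
    (v : κ → ℝ) : HasLaw (fun ω => v ⬝ᵥ fun k => trendIntegral (W k) ω)
      (gaussianReal 0 (v ⬝ᵥ v / 12).toNNReal) P := by
  rcases eq_or_ne v 0 with rfl | hv
  · refine ⟨by simp, ?_⟩
    simp
  have hpos : 0 < v ⬝ᵥ v := by
    have h0 : 0 ≤ v ⬝ᵥ v := dotProduct_self_star_nonneg v
    exact lt_of_le_of_ne h0 fun h => hv (dotProduct_self_eq_zero.1 h.symm)
  set c := √(v ⬝ᵥ v) with hc
  have hc0 : c ≠ 0 := (Real.sqrt_pos.2 hpos).ne'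
  have hc2 : c ^ 2 = v ⬝ᵥ v := Real.sq_sqrt hpos.le
  -- Normalising `v` to a unit row makes `v · W` equal to `c` times a single Brownian motion.
  let Q : Matrix Unit κ ℝ := Matrix.of fun _ k => v k / c
  have hQ : Q * Qᵀ = 1 := by
    ext i j
    rw [Matrix.mul_apply, Subsingleton.elim i j, Matrix.one_apply_eq]
    have : ∀ k, Q j k * Qᵀ k j = v k * v k / c ^ 2 := fun k => by
      simp only [Q, Matrix.transpose_apply, Matrix.of_apply]; ring
    rw [Finset.sum_congr rfl fun k _ => this k, ← Finset.sum_div, hc2]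
    exact div_self hpos.ne'
  have hB := ((hW.rotate hQ).isBrownian ()).hasLaw_trendIntegral
  have hlaw := gaussianReal_const_mul hB c
  have hvar : NNReal.mk (c ^ 2) (sq_nonneg c) * (1 / 12) = (v ⬝ᵥ v / 12).toNNReal := by
    rw [← hc2]
    ext
    rw [Real.coe_toNNReal _ (by positivity)]
    push_cast
    ring
  rw [mul_zero, hvar] at hlaw
  refine hlaw.congr ?_
  filter_upwards [hW.ae_demeanedTrendIntegral_brownianPath (ι := Unit)] with ω hω
  have h1 := congrFun (hω Q) ()
  change v ⬝ᵥ _ = c * demeanedTrendIntegral (brownianPath Q W ω) ()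
  rw [h1]
  simp only [Matrix.mulVec, dotProduct, Q, Matrix.of_apply, Finset.mul_sum]
  refine Finset.sum_congr rfl fun k _ => ?_
  field_simp

theorem hasLaw_mulVec_trendIntegral [Fintype ι] [DecidableEq ι] [IsProbabilityMeasure P]
    (hW : IsWienerVector W P) (A : Matrix ι κ ℝ) :
    HasLaw (fun ω => WithLp.toLp 2 (A *ᵥ fun k => trendIntegral (W k) ω))
      (multivariateGaussian 0 ((1 / 12 : ℝ) • (A * Aᵀ))) P := by
  have hmeas : AEMeasurable (fun ω => WithLp.toLp 2 (A *ᵥ fun k => trendIntegral (W k) ω)) P := by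
    have h1 : AEMeasurable (fun ω k => trendIntegral (W k) ω) P :=
      aemeasurable_pi_lambda _ hW.aemeasurable_trendIntegral
    have h2 : Continuous fun x : κ → ℝ => WithLp.toLp 2 (A *ᵥ x) := by fun_prop
    exact h2.measurable.comp_aemeasurable h1
  refine ⟨hmeas, ?_⟩
  have : IsProbabilityMeasure
      (P.map fun ω => WithLp.toLp 2 (A *ᵥ fun k => trendIntegral (W k) ω)) :=
    Measure.isProbabilityMeasure_map hmeas
  have hS : ((1 / 12 : ℝ) • (A * Aᵀ)).PosSemidef :=
    (Matrix.posSemidef_self_mul_conjTranspose A).smul (by norm_num)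
  refine Measure.ext_of_charFun (funext fun t => ?_)
  rw [charFun_multivariateGaussian hS, charFun_apply, integral_map hmeas (by fun_prop)]
  -- Cramér–Wold: the joint characteristic function at `t` is that of the scalar projection along
  -- `Aᵀt`, evaluated at `1`.
  have hlaw := hW.hasLaw_sum_trendIntegral (Aᵀ *ᵥ t.ofLp)
  have h1 := congrArg (fun μ => charFun μ 1) hlaw.map_eq
  simp only [charFun_gaussianReal] at h1
  rw [charFun_apply_real, integral_map hlaw.aemeasurable (by fun_prop)] at h1
  have hnn : 0 ≤ (Aᵀ *ᵥ t.ofLp) ⬝ᵥ (Aᵀ *ᵥ t.ofLp) := dotProduct_self_star_nonneg _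
  have hq : t.ofLp ⬝ᵥ ((1 / 12 : ℝ) • (A * Aᵀ)) *ᵥ t.ofLp =
      (Aᵀ *ᵥ t.ofLp) ⬝ᵥ (Aᵀ *ᵥ t.ofLp) / 12 := by
    rw [Matrix.smul_mulVec, dotProduct_smul, ← Matrix.mulVec_mulVec, Matrix.dotProduct_mulVec,
      ← Matrix.mulVec_transpose, smul_eq_mul]
    ring
  rw [hq]
  refine Eq.trans (integral_congr_ae (ae_of_all _ fun ω => ?_)) (h1.trans ?_)
  · simp only [Complex.ofReal_one, one_mul]
    congr 3
    rw [Matrix.mulVec_transpose, ← Matrix.dotProduct_mulVec, dotProduct_comm]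
    simp [PiLp.inner_apply, dotProduct, mul_comm]
  · congr 1
    have : (((Aᵀ *ᵥ t.ofLp) ⬝ᵥ (Aᵀ *ᵥ t.ofLp) / 12).toNNReal : ℝ) =
        (Aᵀ *ᵥ t.ofLp) ⬝ᵥ (Aᵀ *ᵥ t.ofLp) / 12 := Real.coe_toNNReal _ (by positivity)
    rw [this, inner_zero_right]
    push_cast
    ring

end IsWienerVector

end Wiener

/-! ### The functional `X ↦ X(1)/2 - ∫₀¹ X` -/

namespace Cadlag

variable {ι : Type*} [Fintype ι]

/-- The functional `X ↦ X(1)/2 - ∫₀¹ X`, which is `∫₀¹ (s - 1/2) dX(s)` if `X` is continuous and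
starts at `0`. -/
def trendMoment (X : Cadlag (ι → ℝ)) : ι → ℝ := (1 / 2 : ℝ) • X.toFun 1 - ∫ r, X.toFun r

theorem continuous_trendMoment : Continuous (trendMoment : Cadlag (ι → ℝ) → ι → ℝ) :=
  Continuous.sub (f := fun X : Cadlag (ι → ℝ) => (1 / 2 : ℝ) • X.toFun 1)
    ((continuous_const_smul _).comp continuous_eval_one) continuous_integral

theorem trendMoment_ofFun {b : unitInterval → ι → ℝ} (hb : Continuous b) (h0 : b 0 = 0) :
    trendMoment (ofFun b) = demeanedTrendIntegral b := by
  rw [ofFun_of_isCadlag hb.isCadlag, demeanedTrendIntegral_eq hb, h0, add_zero]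
  rfl

end Cadlag

/-! ### Sums over time -/

theorem sum_Icc_natCast (T : ℕ) : ∑ t ∈ Finset.Icc 1 T, (t : ℝ) = T * (T + 1) / 2 := by
  induction T with
  | zero => simp
  | succ T ih => rw [Finset.sum_Icc_succ_top (by omega), ih]; push_cast; ring

theorem sum_Icc_natCast_sq (T : ℕ) :
    ∑ t ∈ Finset.Icc 1 T, (t : ℝ) * t = T * (T + 1) * (2 * T + 1) / 6 := by
  induction T with
  | zero => simp
  | succ T ih => rw [Finset.sum_Icc_succ_top (by omega), ih]; push_cast; ring

theorem sum_Icc_natCast_mul (u : ℕ → ℝ) (T : ℕ) :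
    ∑ t ∈ Finset.Icc 1 T, (t : ℝ) * u t =
      T * ∑ t ∈ Finset.Icc 1 T, u t - ∑ k ∈ Finset.range T, ∑ t ∈ Finset.Icc 1 k, u t := by
  induction T with
  | zero => simp
  | succ T ih =>
    rw [Finset.sum_Icc_succ_top (by omega), ih, Finset.sum_range_succ,
      Finset.sum_Icc_succ_top (by omega)]
    push_cast
    ring

theorem trendCross_eq {T : ℕ} (hT : T ≠ 0) (x : ℕ → ℝ) :
    trendCross T x = ∑ t ∈ Finset.Icc 1 T, (t : ℝ) * x t -
      ((T : ℝ) + 1) / 2 * ∑ t ∈ Finset.Icc 1 T, x t := by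
  have hT' : (T : ℝ) ≠ 0 := Nat.cast_ne_zero.2 hT
  have hm : (sampleMean T fun s => (s : ℝ)) = ((T : ℝ) + 1) / 2 := by
    rw [sampleMean, sum_Icc_natCast]
    field_simp
  rw [trendCross, hm]
  have h1 (t : ℕ) : ((t : ℝ) - ((T : ℝ) + 1) / 2) * (x t - sampleMean T x) =
      t * x t - ((T : ℝ) + 1) / 2 * x t - (t * sampleMean T x -
        ((T : ℝ) + 1) / 2 * sampleMean T x) := by ring
  rw [Finset.sum_congr rfl fun t _ => h1 t, Finset.sum_sub_distrib, Finset.sum_sub_distrib,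
    Finset.sum_sub_distrib, ← Finset.mul_sum, ← Finset.sum_mul, sum_Icc_natCast,
    Finset.sum_const, Nat.card_Icc, nsmul_eq_mul]
  push_cast [Nat.add_sub_cancel]
  ring

theorem trendCross_trend_add {T : ℕ} (hT : T ≠ 0) (m b : ℝ) (u : ℕ → ℝ) :
    (trendCross T fun t => m + b * t + u t) =
      b * (T * ((T : ℝ) ^ 2 - 1) / 12) + trendCross T u := by
  rw [trendCross_eq hT, trendCross_eq hT]
  have h1 (t : ℕ) : (t : ℝ) * (m + b * t + u t) = m * t + b * (t * t) + t * u t := by ring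
  rw [Finset.sum_congr rfl fun t _ => h1 t]
  simp only [Finset.sum_add_distrib, ← Finset.mul_sum]
  rw [sum_Icc_natCast, sum_Icc_natCast_sq, Finset.sum_const, Nat.card_Icc, nsmul_eq_mul]
  push_cast [Nat.add_sub_cancel]
  ring

theorem partialSumPath_one {ι Ω : Type*} [Fintype ι] (U : ℕ → Ω → ι → ℝ) (T : ℕ) (ω : Ω) :
    (partialSumPath U T ω).toFun 1 =
      (T : ℝ) ^ (-(1 / 2) : ℝ) • ∑ t ∈ Finset.Icc 1 T, U t ω := by
  simp [partialSumPath, Cadlag.step]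

/-- Abel summation turns `∑ t u_t` into partial sums, whose average is the integral of the step
path. The correction of order `1/T` arises because `t̄` is `(T+1)/2` and not `T/2`. -/
theorem trendCross_eq_trendMoment {ι Ω : Type*} [Fintype ι] (U : ℕ → Ω → ι → ℝ) {T : ℕ}
    (hT : T ≠ 0) (ω : Ω) (i : ι) :
    (T : ℝ) ^ (-(3 / 2) : ℝ) * (trendCross T fun t => U t ω i) =
      Cadlag.trendMoment (partialSumPath U T ω) i -
        1 / 2 * (T : ℝ)⁻¹ * (partialSumPath U T ω).toFun 1 i := by
  have hT' : (0 : ℝ) < T := Nat.cast_pos.2 (Nat.pos_of_ne_zero hT)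
  have hpow : (T : ℝ) ^ (-(3 / 2) : ℝ) = (T : ℝ) ^ (-(1 / 2) : ℝ) * (T : ℝ)⁻¹ := by
    rw [← Real.rpow_neg_one, ← Real.rpow_add hT']
    norm_num
  have hint : ∫ r, (partialSumPath U T ω).toFun r = (T : ℝ)⁻¹ • ∑ k ∈ Finset.range T,
      (T : ℝ) ^ (-(1 / 2) : ℝ) • ∑ t ∈ Finset.Icc 1 k, U t ω := Cadlag.integral_step hT _
  rw [trendCross_eq hT, sum_Icc_natCast_mul, Cadlag.trendMoment, hint, partialSumPath_one, hpow]
  simp only [Pi.sub_apply, Pi.smul_apply, Finset.sum_apply, smul_eq_mul, ← Finset.mul_sum]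
  field_simp
  ring

/-! ### The estimator -/

section Estimator

variable {n : ℕ} {Ω : Type*}

/-- Numerator and denominator of the estimator share the factor `T^{3-κ}`, which cancels, and `β̄₁ =
θ β̄₂` removes the trend from the numerator of the error. When the denominator vanishes, `0⁻¹ = 0`
makes the estimator `0` and the error `-θ`; keeping this branch makes the identity hold for every
outcome. -/
theorem ivError_eq (μ₁ μ₂ βbar₁ βbar₂ : Fin n → ℝ) (κ : ℝ) (U : ℕ → Ω → Fin n ⊕ Fin n → ℝ)
    {T : ℕ} (hT : T ≠ 0) (ω : Ω) (i : Fin n)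
    (hβ : βbar₁ i = slopeRatio βbar₁ βbar₂ i * βbar₂ i) {z : Fin n ⊕ Fin n → ℝ}
    (hz : ∀ j, (T : ℝ) ^ (-(3 / 2) : ℝ) * (trendCross T fun t => U t ω j) = z j)
    {a δ : ℝ} (ha : a = (1 - ((T : ℝ)⁻¹) ^ 2) / 12) (hδ : δ = (T : ℝ) ^ (κ - 3 / 2)) :
    (T : ℝ) ^ (3 / 2 - κ) * ivError μ₁ μ₂ βbar₁ βbar₂ κ U T ω i =
      if a * βbar₂ i + δ * z (Sum.inr i) = 0 then -(δ⁻¹ * slopeRatio βbar₁ βbar₂ i) else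
        (a * βbar₂ i + δ * z (Sum.inr i))⁻¹ *
          (z (Sum.inl i) - slopeRatio βbar₁ βbar₂ i * z (Sum.inr i)) := by
  have hT' : (0 : ℝ) < T := Nat.cast_pos.2 (Nat.pos_of_ne_zero hT)
  have hδ0 : δ ≠ 0 := hδ ▸ (Real.rpow_pos_of_pos hT' _).ne'
  have hδinv : (T : ℝ) ^ (3 / 2 - κ) = δ⁻¹ := by
    rw [hδ, ← Real.rpow_neg hT'.le, neg_sub]
  have hc : (T : ℝ) ^ (3 - κ) ≠ 0 := (Real.rpow_pos_of_pos hT' _).ne'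
  have h1 : (T : ℝ) ^ (-κ) * (T * ((T : ℝ) ^ 2 - 1) / 12) = (T : ℝ) ^ (3 - κ) * a := by
    rw [sub_eq_add_neg 3 κ, Real.rpow_add hT', ha, show (3 : ℝ) = ((3 : ℕ) : ℝ) by norm_num,
      Real.rpow_natCast]
    field_simp
  have h2 (j : Fin n ⊕ Fin n) :
      (trendCross T fun t => U t ω j) = (T : ℝ) ^ (3 - κ) * (δ * z j) := by
    rw [← hz, hδ, ← mul_assoc, ← mul_assoc, ← Real.rpow_add hT', ← Real.rpow_add hT']
    ring_nf
    simp
  have hcross (m : ℝ) (βbar : Fin n → ℝ) (j : Fin n ⊕ Fin n) :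
      (trendCross T fun t => m + localSlope κ βbar T i * t + U t ω j) =
        (T : ℝ) ^ (3 - κ) * (a * βbar i + δ * z j) := by
    rw [trendCross_trend_add hT, h2]
    simp only [localSlope, Pi.smul_apply, smul_eq_mul]
    rw [mul_right_comm, h1]
    ring
  have herr : ivError μ₁ μ₂ βbar₁ βbar₂ κ U T ω i =
      (a * βbar₂ i + δ * z (Sum.inr i))⁻¹ * (a * βbar₁ i + δ * z (Sum.inl i)) -
        slopeRatio βbar₁ βbar₂ i := by
    rw [ivError, slopeRatio_localSlope κ βbar₁ βbar₂ (Nat.one_le_iff_ne_zero.2 hT), Pi.sub_apply]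
    congr 1
    simp only [thetaHat, ivEstimator, trendSeries]
    rw [hcross, hcross, mul_inv, mul_mul_mul_comm, inv_mul_cancel₀ hc, one_mul]
  rw [herr, hδinv]
  split_ifs with h
  · rw [h]; simp
  · rw [hβ]
    generalize slopeRatio βbar₁ βbar₂ i = θ at *
    field_simp
    ring

theorem aemeasurable_trendCross [MeasurableSpace Ω] {P : Measure Ω} {x : ℕ → Ω → ℝ}
    (hx : ∀ t, AEMeasurable (x t) P) (T : ℕ) :
    AEMeasurable (fun ω => trendCross T fun t => x t ω) P := by
  have h : AEMeasurable (fun ω => sampleMean T fun t => x t ω) P :=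
    (Finset.aemeasurable_fun_sum _ fun t _ => hx t).const_mul _
  exact Finset.aemeasurable_fun_sum _ fun t _ => ((hx t).sub h).const_mul _

theorem aemeasurable_ivError [MeasurableSpace Ω] {P : Measure Ω}
    {U : ℕ → Ω → Fin n ⊕ Fin n → ℝ} (hU : ∀ t, AEMeasurable (U t) P)
    (μ₁ μ₂ βbar₁ βbar₂ : Fin n → ℝ) (κ : ℝ) (T : ℕ) :
    AEMeasurable (fun ω => ivError μ₁ μ₂ βbar₁ βbar₂ κ U T ω) P := by
  have hU' (t : ℕ) (j : Fin n ⊕ Fin n) : AEMeasurable (fun ω => U t ω j) P :=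
    (measurable_pi_apply j).comp_aemeasurable (hU t)
  refine aemeasurable_pi_lambda _ fun i => AEMeasurable.sub_const (AEMeasurable.mul ?_ ?_) _
  · exact (aemeasurable_trendCross (fun t => (hU' t (Sum.inr i)).const_add _) T).inv
  · exact aemeasurable_trendCross (fun t => (hU' t (Sum.inl i)).const_add _) T

/-- The scaled estimation error as a function of `((f, e), (a, δ, τ))`, where the noise enters
through `f - τ e`, and `a`, `δ` weigh trend and noise. -/
def scaledError (θ β : Fin n → ℝ)
    (p : ((Fin n ⊕ Fin n → ℝ) × (Fin n ⊕ Fin n → ℝ)) × (ℝ × ℝ × ℝ)) : Fin n → ℝ := fun i =>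
  if p.2.1 * β i + p.2.2.1 * (p.1.1 (Sum.inr i) - p.2.2.2 * p.1.2 (Sum.inr i)) = 0 then
    -(p.2.2.1⁻¹ * θ i)
  else (p.2.1 * β i + p.2.2.1 * (p.1.1 (Sum.inr i) - p.2.2.2 * p.1.2 (Sum.inr i)))⁻¹ *
    ((p.1.1 (Sum.inl i) - p.2.2.2 * p.1.2 (Sum.inl i)) -
      θ i * (p.1.1 (Sum.inr i) - p.2.2.2 * p.1.2 (Sum.inr i)))

theorem measurable_scaledError (θ β : Fin n → ℝ) : Measurable (scaledError θ β) := by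
  refine measurable_pi_lambda _ fun i => Measurable.ite ?_ ?_ ?_
  · exact measurableSet_eq_fun (by fun_prop) (by fun_prop)
  · fun_prop
  · fun_prop

theorem continuousAt_scaledError (θ β : Fin n → ℝ)
    {p : ((Fin n ⊕ Fin n → ℝ) × (Fin n ⊕ Fin n → ℝ)) × (ℝ × ℝ × ℝ)}
    (hp : ∀ i, p.2.1 * β i +
      p.2.2.1 * (p.1.1 (Sum.inr i) - p.2.2.2 * p.1.2 (Sum.inr i)) ≠ 0) :
    ContinuousAt (scaledError θ β) p := by
  refine continuousAt_pi.2 fun i => ?_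
  have hD : Continuous fun p : ((Fin n ⊕ Fin n → ℝ) × (Fin n ⊕ Fin n → ℝ)) × (ℝ × ℝ × ℝ) =>
      p.2.1 * β i + p.2.2.1 * (p.1.1 (Sum.inr i) - p.2.2.2 * p.1.2 (Sum.inr i)) := by fun_prop
  have hN : Continuous fun p : ((Fin n ⊕ Fin n → ℝ) × (Fin n ⊕ Fin n → ℝ)) × (ℝ × ℝ × ℝ) =>
      (p.1.1 (Sum.inl i) - p.2.2.2 * p.1.2 (Sum.inl i)) -
      θ i * (p.1.1 (Sum.inr i) - p.2.2.2 * p.1.2 (Sum.inr i)) := by fun_prop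
  refine ((hD.continuousAt.inv₀ (hp i)).mul hN.continuousAt).congr ?_
  filter_upwards [hD.continuousAt.eventually_ne (hp i)] with q hq
  exact (if_neg hq).symm

end Estimator

/-! ### Common limit theorem for the scaled error -/

section Limit

variable {n : ℕ} {Ω : Type*} [MeasurableSpace Ω] {P : Measure Ω} [IsProbabilityMeasure P]
  {Ω' : Type*} [MeasurableSpace Ω'] {P' : Measure Ω'} [IsProbabilityMeasure P']

/-- The limit law of the scaled estimation error. -/
theorem tendstoInDistribution_ivError {U : ℕ → Ω → Fin n ⊕ Fin n → ℝ}
    (hU : ∀ t, AEMeasurable (U t) P) {Λu : Matrix (Fin n ⊕ Fin n) (Fin n ⊕ Fin n) ℝ}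
    {Wu : Fin n ⊕ Fin n → ℝ≥0 → Ω' → ℝ} (hWu : IsWienerVector Wu P')
    (hFCLT : TendstoInDistribution (fun T ω => partialSumPath U T ω) atTop
      (fun ω => Cadlag.ofFun (brownianPath Λu Wu ω)) (fun _ => P) P')
    (μ₁ μ₂ βbar₁ βbar₂ : Fin n → ℝ) (hβ : ∀ i, βbar₁ i = slopeRatio βbar₁ βbar₂ i * βbar₂ i)
    {κ d : ℝ} (hd : Tendsto (fun T : ℕ => (T : ℝ) ^ (κ - 3 / 2)) atTop (𝓝 d))
    (hne : ∀ᵐ ω ∂P', ∀ i, 1 / 12 * βbar₂ i +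
      d * demeanedTrendIntegral (brownianPath Λu Wu ω) (Sum.inr i) ≠ 0) :
    TendstoInDistribution
      (fun (T : ℕ) ω => (T : ℝ) ^ (3 / 2 - κ) • ivError μ₁ μ₂ βbar₁ βbar₂ κ U T ω) atTop
      (fun ω i => (1 / 12 * βbar₂ i +
          d * demeanedTrendIntegral (brownianPath Λu Wu ω) (Sum.inr i))⁻¹ *
        (demeanedTrendIntegral (brownianPath Λu Wu ω) (Sum.inl i) - slopeRatio βbar₁ βbar₂ i *
          demeanedTrendIntegral (brownianPath Λu Wu ω) (Sum.inr i)))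
      (fun _ => P) P' := by
  have hmom : ∀ᵐ ω ∂P', Cadlag.trendMoment (Cadlag.ofFun (brownianPath Λu Wu ω)) =
      demeanedTrendIntegral (brownianPath Λu Wu ω) := by
    filter_upwards [hWu.ae_continuous_brownianPath (ι := Fin n ⊕ Fin n),
      hWu.ae_brownianPath_zero (ι := Fin n ⊕ Fin n)] with ω h1 h2
    exact Cadlag.trendMoment_ofFun (h1 Λu) (h2 Λu)
  have hjoint := hFCLT.continuous_comp
    (g := fun X : Cadlag (Fin n ⊕ Fin n → ℝ) => (Cadlag.trendMoment X, X.toFun 1))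
    (Cadlag.continuous_trendMoment.prodMk Cadlag.continuous_eval_one)
  have hinv : Tendsto (fun T : ℕ => (T : ℝ)⁻¹) atTop (𝓝 0) := tendsto_inv_atTop_nhds_zero_nat
  have hpar : Tendsto (fun T : ℕ => ((1 - ((T : ℝ)⁻¹) ^ 2) / 12, (T : ℝ) ^ (κ - 3 / 2),
      1 / 2 * (T : ℝ)⁻¹)) atTop (𝓝 (1 / 12, d, 0)) := by
    refine Tendsto.prodMk_nhds ?_ (hd.prodMk_nhds ?_)
    · simpa using ((hinv.pow 2).const_sub 1).div_const 12
    · simpa only [mul_zero] using hinv.const_mul (1 / 2)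
  -- Slutsky: the deterministic weights join the random vector as components with a constant limit,
  -- so that one fixed map, independent of `T`, yields the scaled error.
  have hslut := hjoint.prodMk_of_tendstoInMeasure_const _
    (fun (T : ℕ) (_ : Ω) => ((1 - ((T : ℝ)⁻¹) ^ 2) / 12, (T : ℝ) ^ (κ - 3 / 2),
      1 / 2 * (T : ℝ)⁻¹)) _ (c := (1 / 12, d, 0))
    (tendstoInMeasure_of_tendsto_ae (fun _ => aestronglyMeasurable_const)
      (ae_of_all _ fun _ => hpar)) fun _ => aemeasurable_const
  have hmap := hslut.comp_of_ae_continuousAt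
    (measurable_scaledError (slopeRatio βbar₁ βbar₂) βbar₂) (by
      filter_upwards [hne, hmom] with ω h1 h2
      refine continuousAt_scaledError _ _ fun i => ?_
      simp only [Function.comp_apply, h2, zero_mul, sub_zero]
      exact h1 i)
  refine (hmap.congr_of_eventually ?_ fun T => ?_).congr (fun _ => ae_eq_rfl) ?_
  · filter_upwards [eventually_ne_atTop 0] with T hT
    refine ae_of_all _ fun ω => funext fun i => ?_
    exact (ivError_eq μ₁ μ₂ βbar₁ βbar₂ κ U hT ω i (hβ i)
      (fun j => trendCross_eq_trendMoment U hT ω j) rfl rfl).symm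
  · exact AEMeasurable.const_smul (g := fun ω => ivError μ₁ μ₂ βbar₁ βbar₂ κ U T ω)
      (aemeasurable_ivError hU μ₁ μ₂ βbar₁ βbar₂ κ T) ((T : ℝ) ^ (3 / 2 - κ))
  · filter_upwards [hne, hmom] with ω h1 h2
    funext i
    simp only [scaledError, Function.comp_apply, h2, zero_mul, sub_zero]
    rw [if_neg (h1 i)]

end Limit

/-! ### The contrast matrix and linear images of the noise -/

theorem contrast_mulVec {n : ℕ} (θ : Fin n → ℝ) (x : Fin n ⊕ Fin n → ℝ) (i : Fin n) :
    (contrast θ *ᵥ x) i = x (Sum.inl i) - θ i * x (Sum.inr i) := by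
  rw [contrast, ← Sum.elim_comp_inl_inr x, Matrix.fromCols_mulVec_sumElim, Matrix.one_mulVec,
    Matrix.neg_mulVec, Pi.add_apply, Pi.neg_apply, Matrix.mulVec_diagonal]
  simp [sub_eq_add_neg]

theorem errorVariance_eq {n : ℕ} (θ : Fin n → ℝ)
    (Λu : Matrix (Fin n ⊕ Fin n) (Fin n ⊕ Fin n) ℝ) :
    errorVariance θ Λu = (contrast θ * Λu) * (contrast θ * Λu)ᵀ := by
  rw [errorVariance, Matrix.transpose_mul]
  simp only [Matrix.mul_assoc]

theorem Matrix.inv_diagonal_of_ne_zero {ι : Type*} [Fintype ι] [DecidableEq ι] {v : ι → ℝ}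
    (hv : ∀ i, v i ≠ 0) : (Matrix.diagonal v)⁻¹ = Matrix.diagonal fun i => (v i)⁻¹ := by
  refine Matrix.inv_eq_right_inv ?_
  rw [Matrix.diagonal_mul_diagonal, ← Matrix.diagonal_one]
  congr 1
  funext i
  exact mul_inv_cancel₀ (hv i)

theorem partialSumPath_mulVec {ι κ Ω : Type*} [Fintype ι] [Fintype κ] (A : Matrix ι κ ℝ)
    {hA : Continuous A.mulVec} (U : ℕ → Ω → κ → ℝ) (T : ℕ) (ω : Ω) :
    partialSumPath (fun t ω => A *ᵥ U t ω) T ω = Cadlag.map A.mulVec hA (partialSumPath U T ω) := by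
  simp only [partialSumPath, Cadlag.step, Cadlag.map]
  congr 1
  funext r
  rw [Matrix.mulVec_smul]
  congr 1
  exact (map_sum A.mulVecLin _ _).symm

/-- The functional central limit theorem for linear combinations of the noise. -/
theorem tendstoInDistribution_partialSumPath_mulVec {ι κ Ω Ω' : Type*} [Fintype ι] [Fintype κ]
    [MeasurableSpace Ω] {P : Measure Ω} [IsProbabilityMeasure P]
    [MeasurableSpace Ω'] {P' : Measure Ω'} [IsProbabilityMeasure P'] {U : ℕ → Ω → κ → ℝ}
    {b : Ω' → unitInterval → κ → ℝ}
    (hFCLT : TendstoInDistribution (fun T ω => partialSumPath U T ω) atTop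
      (fun ω => Cadlag.ofFun (b ω)) (fun _ => P) P')
    (hb : ∀ᵐ ω ∂P', Continuous (b ω)) (A : Matrix ι κ ℝ) :
    TendstoInDistribution (fun T ω => partialSumPath (fun t ω => A *ᵥ U t ω) T ω) atTop
      (fun ω => Cadlag.ofFun fun r => A *ᵥ b ω r) (fun _ => P) P' := by
  have hlip := A.mulVecLin.toContinuousLinearMap.lipschitz
  have h := hFCLT.continuous_comp (Cadlag.continuous_map hlip)
  refine h.congr (fun T => ae_of_all _ fun ω => ?_) ?_
  · exact (partialSumPath_mulVec A U T ω).symm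
  · filter_upwards [hb] with ω hω
    have hA : Continuous fun r => A *ᵥ b ω r := continuous_const.matrix_mulVec hω
    rw [Function.comp_apply, Cadlag.ofFun_of_isCadlag hω.isCadlag,
      Cadlag.ofFun_of_isCadlag hA.isCadlag]
    rfl

/-! ### Gaussian functionals have no atoms unless degenerate -/

namespace IsWienerVector

variable {Ω κ : Type*} [MeasurableSpace Ω] {P : Measure Ω} [IsProbabilityMeasure P] [Fintype κ]
  {W : κ → ℝ≥0 → Ω → ℝ}

/-- If `c + ∫₀¹ (s - 1/2) d(v · W)(s)` vanishes with positive probability, then `c` and `v` do. -/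
theorem ae_add_ne_zero (hW : IsWienerVector W P) (v : κ → ℝ) (c : ℝ) (h : c ≠ 0 ∨ v ≠ 0) :
    ∀ᵐ ω ∂P, c + v ⬝ᵥ (fun k => trendIntegral (W k) ω) ≠ 0 := by
  rcases eq_or_ne v 0 with rfl | hv
  · have hc : c ≠ 0 := h.resolve_right fun h => h rfl
    exact ae_of_all _ fun ω => by simpa using hc
  have hlaw := hW.hasLaw_sum_trendIntegral v
  have hpos : 0 < v ⬝ᵥ v / 12 := by
    have h0 : 0 ≤ v ⬝ᵥ v := dotProduct_self_star_nonneg v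
    have := lt_of_le_of_ne h0 fun h => hv (dotProduct_self_eq_zero.1 h.symm)
    positivity
  have := nullSingletonClass_gaussianReal (μ := 0) (Real.toNNReal_pos.2 hpos).ne'
  have h1 : ∀ᵐ x ∂(P.map fun ω => v ⬝ᵥ fun k => trendIntegral (W k) ω), x ≠ -c := by
    rw [hlaw.map_eq, ae_iff]
    simp
  filter_upwards [ae_of_ae_map hlaw.aemeasurable h1] with ω hω hω'
  exact hω (by linarith)

/-- `∫₀¹ (s - 1/2) d(v · W)(s)` is almost surely constant only if `v = 0`. -/
theorem eq_zero_of_ae_eq_const (hW : IsWienerVector W P) {v : κ → ℝ} {c : ℝ}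
    (h : ∀ᵐ ω ∂P, (v ⬝ᵥ fun k => trendIntegral (W k) ω) = c) : c = 0 ∧ v = 0 := by
  by_contra hcon
  have h1 : -c ≠ 0 ∨ v ≠ 0 := by
    rw [neg_ne_zero]
    tauto
  have h2 := h.and (hW.ae_add_ne_zero v (-c) h1)
  obtain ⟨ω, h3, h4⟩ := h2.exists
  exact h4 (by rw [h3]; ring)

end IsWienerVector

/-! ### Matrix form and nondegeneracy of the limits -/

section Limits

variable {n : ℕ} {Ω' : Type*} [MeasurableSpace Ω'] {P' : Measure Ω'}
  {Λu : Matrix (Fin n ⊕ Fin n) (Fin n ⊕ Fin n) ℝ} {Wu : Fin n ⊕ Fin n → ℝ≥0 → Ω' → ℝ}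

theorem ae_mulVec_demeanedTrendIntegral_eq {θ : Fin n → ℝ} {Λε : Matrix (Fin n) (Fin n) ℝ}
    {Wε : Fin n → ℝ≥0 → Ω' → ℝ} (hWu : IsWienerVector Wu P') (hWε : IsWienerVector Wε P')
    (h : ∀ᵐ ω ∂P', ∀ r, brownianPath Λε Wε ω r = contrast θ *ᵥ brownianPath Λu Wu ω r) :
    ∀ᵐ ω ∂P', Λε *ᵥ demeanedTrendIntegral (brownianPath 1 Wε ω) =
      contrast θ *ᵥ demeanedTrendIntegral (brownianPath Λu Wu ω) := by
  filter_upwards [h, hWu.ae_continuous_brownianPath (ι := Fin n ⊕ Fin n),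
    hWε.ae_demeanedTrendIntegral_brownianPath (ι := Fin n)] with ω h1 h2 h3
  rw [demeanedTrendIntegral_brownianPath_one, ← h3 Λε, ← demeanedTrendIntegral_mulVec _ (h2 Λu)]
  congr 1
  exact funext h1

/-- The limit of the scaled estimation error, in matrix form. -/
theorem ae_limit_eq {θ β : Fin n → ℝ} {d : ℝ} {x : Ω' → Fin n → ℝ} {Z : Ω' → Fin n ⊕ Fin n → ℝ}
    (hne : ∀ᵐ ω ∂P', ∀ i, 1 / 12 * β i + d * Z ω (Sum.inr i) ≠ 0)
    (hx : ∀ᵐ ω ∂P', x ω = contrast θ *ᵥ Z ω) :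
    (fun ω i => (1 / 12 * β i + d * Z ω (Sum.inr i))⁻¹ *
      (Z ω (Sum.inl i) - θ i * Z ω (Sum.inr i))) =ᵐ[P']
    fun ω => (Matrix.diagonal fun i => 1 / 12 * β i + d * Z ω (Sum.inr i))⁻¹ *ᵥ x ω := by
  filter_upwards [hne, hx] with ω h1 h2
  funext i
  rw [Matrix.inv_diagonal_of_ne_zero h1, Matrix.mulVec_diagonal, h2, contrast_mulVec]

variable [IsProbabilityMeasure P']

/-- Either alternative makes the affine Gaussian denominator nondegenerate at zero: a nonzero trend
serves Cases 1 and 2, a nonzero noise variance Case 3. -/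
theorem ae_trend_add_demeanedTrendIntegral_ne_zero (hWu : IsWienerVector Wu P') {β : Fin n → ℝ}
    {d : ℝ} (h : ∀ i, β i ≠ 0 ∨ d ≠ 0 ∧ (Λu * Λuᵀ) (Sum.inr i) (Sum.inr i) ≠ 0) :
    ∀ᵐ ω ∂P', ∀ i, 1 / 12 * β i +
      d * demeanedTrendIntegral (brownianPath Λu Wu ω) (Sum.inr i) ≠ 0 := by
  refine ae_all_iff.2 fun i => ?_
  have h1 : 1 / 12 * β i ≠ 0 ∨ d • Λu (Sum.inr i) ≠ 0 := by
    refine (h i).imp (fun h => mul_ne_zero (by norm_num) h) fun h => smul_ne_zero h.1 fun h0 => ?_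
    exact h.2 (by rw [Matrix.mul_apply]; simp [h0])
  filter_upwards [hWu.ae_add_ne_zero _ _ h1,
    hWu.ae_demeanedTrendIntegral_brownianPath (ι := Fin n ⊕ Fin n)] with ω h2 h3
  rwa [h3 Λu, Matrix.mulVec, ← smul_eq_mul d, ← smul_dotProduct]

/-- The limit in the case of very small slopes is nondegenerate. -/
theorem not_ae_eq_const_limit (hWu : IsWienerVector Wu P') {θ β : Fin n → ℝ}
    (hβ : ∀ i, β i ≠ 0) {i : Fin n} (hi : errorVariance θ Λu i i ≠ 0) {c : ℝ} :
    ¬ ∀ᵐ ω ∂P', (1 / 12 * β i + 1 * demeanedTrendIntegral (brownianPath Λu Wu ω) (Sum.inr i))⁻¹ *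
      (demeanedTrendIntegral (brownianPath Λu Wu ω) (Sum.inl i) -
        θ i * demeanedTrendIntegral (brownianPath Λu Wu ω) (Sum.inr i)) = c := by
  intro h
  -- Clearing the denominator turns a constant ratio into a constant linear combination of the
  -- Gaussian integrals.
  have hlin : ∀ᵐ ω ∂P', (((contrast θ * Λu) i - c • Λu (Sum.inr i)) ⬝ᵥ
      fun k => trendIntegral (Wu k) ω) = c * (1 / 12 * β i) := by
    filter_upwards [h, hWu.ae_demeanedTrendIntegral_brownianPath (ι := Fin n ⊕ Fin n),
      ae_trend_add_demeanedTrendIntegral_ne_zero (Λu := Λu) hWu (β := β) (d := 1)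
        fun i => Or.inl (hβ i)] with ω h1 h2 h3
    have h4 := (inv_mul_eq_iff_eq_mul₀ (h3 i)).1 h1
    rw [← contrast_mulVec, h2 Λu, Matrix.mulVec_mulVec] at h4
    simp only [Matrix.mulVec] at h4
    rw [sub_dotProduct, smul_dotProduct, h4, smul_eq_mul]
    ring
  obtain ⟨h1, h2⟩ := hWu.eq_zero_of_ae_eq_const hlin
  have hc : c = 0 := (mul_eq_zero.1 h1).resolve_right (mul_ne_zero (by norm_num) (hβ i))
  rw [hc, zero_smul, sub_zero] at h2
  refine hi ?_
  rw [errorVariance_eq, Matrix.mul_apply]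
  simp [h2]

end Limits

/-- If a sequence of random vectors converges in distribution and one of its coordinates tends to
`0` in probability, then that coordinate of the limit vanishes. -/
theorem ae_eq_zero_of_tendstoInMeasure_zero {Ω Ω' : Type*} [MeasurableSpace Ω] {P : Measure Ω}
    [IsProbabilityMeasure P] [MeasurableSpace Ω'] {P' : Measure Ω'} [IsProbabilityMeasure P']
    {ι : Type*} [Fintype ι] {X : ℕ → Ω → ι → ℝ} {Z : Ω' → ι → ℝ}
    (hX : TendstoInDistribution X atTop Z (fun _ => P) P') {i : ι}
    (h0 : TendstoInMeasure P (fun T ω => X T ω i) atTop fun _ => 0) : ∀ᵐ ω ∂P', Z ω i = 0 := by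
  have h := hX.continuous_comp (continuous_apply i)
  -- The coordinate also converges in distribution to `0`, so by uniqueness its limit law is the
  -- Dirac mass at `0`.
  have h1 := tendstoInDistribution_unique _ h
    (TendstoInMeasure.tendstoInDistribution h0 h.forall_aemeasurable)
  rw [Measure.map_const, measure_univ, one_smul] at h1
  refine ae_of_ae_map (f := fun ω => Z ω i) h.aemeasurable_limit (p := fun x => x = 0) ?_
  refine Eq.mpr (congrArg (fun μ : Measure ℝ => ∀ᵐ x ∂μ, x = 0) h1) ?_
  exact (ae_dirac_iff (p := fun x : ℝ => x = 0) (measurableSet_singleton 0)).2 rfl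

/-! ### Zero slopes and the normal limit -/

section Cases

variable {n : ℕ} {Ω : Type*} [MeasurableSpace Ω] {P : Measure Ω} [IsProbabilityMeasure P]
  {Ω' : Type*} [MeasurableSpace Ω'] {P' : Measure Ω'} [IsProbabilityMeasure P']

/-- The limit law of the estimator when all slopes vanish. -/
theorem tendstoInDistribution_thetaHat_zero_slopes {U : ℕ → Ω → Fin n ⊕ Fin n → ℝ}
    (hU : ∀ t, AEMeasurable (U t) P) {Λu : Matrix (Fin n ⊕ Fin n) (Fin n ⊕ Fin n) ℝ}
    {Wu : Fin n ⊕ Fin n → ℝ≥0 → Ω' → ℝ} (hWu : IsWienerVector Wu P')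
    (hFCLT : TendstoInDistribution (fun T ω => partialSumPath U T ω) atTop
      (fun ω => Cadlag.ofFun (brownianPath Λu Wu ω)) (fun _ => P) P')
    (μ₁ μ₂ : Fin n → ℝ) (hvar : ∀ i, (Λu * Λuᵀ) (Sum.inr i) (Sum.inr i) ≠ 0) :
    TendstoInDistribution (fun T ω => thetaHat μ₁ μ₂ 0 0 U T ω) atTop
      (fun ω => (Matrix.diagonal
          (fun i => demeanedTrendIntegral (brownianPath Λu Wu ω) (Sum.inr i)))⁻¹ *ᵥ
        fun i => demeanedTrendIntegral (brownianPath Λu Wu ω) (Sum.inl i))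
      (fun _ => P) P' := by
  have hne := ae_trend_add_demeanedTrendIntegral_ne_zero (Λu := Λu) (β := 0) (d := 1) hWu
    fun i => Or.inr ⟨one_ne_zero, hvar i⟩
  -- Zero slopes are local slopes with `β̄ = 0`. The choice `κ = 3/2` makes the scaling trivial, and
  -- since `0 / 0 = 0` the error is the estimator itself.
  have hlim := tendstoInDistribution_ivError hU hWu hFCLT μ₁ μ₂ 0 0 (by simp) (κ := 3 / 2)
    (d := 1) (by simp) hne
  have hs (κ : ℝ) (T : ℕ) : localSlope κ (0 : Fin n → ℝ) T = 0 := smul_zero _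
  have hr : slopeRatio (0 : Fin n → ℝ) 0 = 0 := funext fun i => div_zero _
  refine hlim.congr (fun T => ae_of_all _ fun ω => ?_) ?_
  · rw [sub_self, Real.rpow_zero, one_smul, ivError, hs, hr, sub_zero]
  · filter_upwards [hne] with ω h1
    funext i
    simp only [Pi.zero_apply, mul_zero, zero_add, one_mul] at h1
    rw [Matrix.inv_diagonal_of_ne_zero h1, Matrix.mulVec_diagonal, hr]
    simp only [Pi.zero_apply, mul_zero, zero_add, one_mul, zero_mul, sub_zero]

/-- The Gaussian limit law of the scaled error in the case of large to small slopes. -/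
theorem hasLaw_inv_diagonal_mulVec_demeanedTrendIntegral {Wε : Fin n → ℝ≥0 → Ω' → ℝ}
    (hWε : IsWienerVector Wε P') {β : Fin n → ℝ} (hβ : ∀ i, β i ≠ 0)
    (Λε : Matrix (Fin n) (Fin n) ℝ) :
    HasLaw
      (fun ω => WithLp.toLp 2 (((1 / 12 : ℝ) • Matrix.diagonal β)⁻¹ *ᵥ
        (Λε *ᵥ demeanedTrendIntegral (brownianPath 1 Wε ω))))
      (multivariateGaussian 0 ((12 : ℝ) • ((Matrix.diagonal β)⁻¹ * (Λε * Λεᵀ) *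
        (Matrix.diagonal β)⁻¹))) P' := by
  have hlaw := hWε.hasLaw_mulVec_trendIntegral (((1 / 12 : ℝ) • Matrix.diagonal β)⁻¹ * Λε)
  have hinv : ((1 / 12 : ℝ) • Matrix.diagonal β)⁻¹ = (12 : ℝ) • (Matrix.diagonal β)⁻¹ := by
    rw [← Matrix.diagonal_smul, Matrix.inv_diagonal_of_ne_zero
      (v := (1 / 12 : ℝ) • β) fun i => mul_ne_zero (by norm_num) (hβ i),
      Matrix.inv_diagonal_of_ne_zero hβ, ← Matrix.diagonal_smul]
    congr 1
    funext i
    simp [mul_comm]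
  have hcov : (1 / 12 : ℝ) • ((((1 / 12 : ℝ) • Matrix.diagonal β)⁻¹ * Λε) *
      (((1 / 12 : ℝ) • Matrix.diagonal β)⁻¹ * Λε)ᵀ) =
      (12 : ℝ) • ((Matrix.diagonal β)⁻¹ * (Λε * Λεᵀ) * (Matrix.diagonal β)⁻¹) := by
    have htr : ((Matrix.diagonal β)⁻¹)ᵀ = (Matrix.diagonal β)⁻¹ := by
      rw [Matrix.transpose_nonsing_inv, Matrix.diagonal_transpose]
    -- The factor is `12² / 12 = 12`: each inverse of `D_β̄₂ / 12` contributes `12`, and the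
    -- integral has variance `1/12`.
    rw [hinv, Matrix.transpose_mul, Matrix.transpose_smul, htr]
    simp only [Matrix.smul_mul, Matrix.mul_smul, smul_smul, Matrix.mul_assoc]
    norm_num
  rw [hcov] at hlaw
  refine hlaw.congr (ae_of_all _ fun ω => ?_)
  simp only [demeanedTrendIntegral_brownianPath_one, Matrix.mulVec_mulVec]

end Cases

end

/-! ### Assembly of the theorem -/

theorem theorem1 {n : ℕ}
    {Ω : Type*} [MeasurableSpace Ω] (P : Measure Ω) [IsProbabilityMeasure P]
    {Ω' : Type*} [MeasurableSpace Ω'] (P' : Measure Ω') [IsProbabilityMeasure P']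
    -- the noise `U_t = (U_{1t}, U_{2t})`, `t = 1, 2, …`
    (U : ℕ → Ω → Fin n ⊕ Fin n → ℝ) (hU : ∀ t, AEMeasurable (U t) P)
    -- the Brownian motion `B_u = Λ_u W_u`
    (Λu : Matrix (Fin n ⊕ Fin n) (Fin n ⊕ Fin n) ℝ)
    (Wu : Fin n ⊕ Fin n → ℝ≥0 → Ω' → ℝ) (hWu : IsWienerVector Wu P')
    -- the functional central limit theorem, in `D([0,1], ℝ^{2n})`
    (hFCLT : TendstoInDistribution (fun T ω => partialSumPath U T ω) atTop
      (fun ω => Cadlag.ofFun (brownianPath Λu Wu ω)) (fun _ => P) P')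
    (μ₁ μ₂ : Fin n → ℝ) :
    -- nonzero slopes `T^{-κ} β̄₁`, `T^{-κ} β̄₂`
    (∀ βbar₁ βbar₂ : Fin n → ℝ, (∀ i, βbar₂ i ≠ 0) →
      ∀ Λε : Matrix (Fin n) (Fin n) ℝ,
      Λε * Λεᵀ = errorVariance (slopeRatio βbar₁ βbar₂) Λu →
      -- `[I_n, -D_θ] B_u` can be written as `Λ_ε W_ε`
      (∃ Wε : Fin n → ℝ≥0 → Ω' → ℝ, IsWienerVector Wε P' ∧
        ∀ᵐ ω ∂P', ∀ r, brownianPath Λε Wε ω r =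
          contrast (slopeRatio βbar₁ βbar₂) *ᵥ brownianPath Λu Wu ω r) ∧
      -- and for each way of doing so:
      ∀ Wε : Fin n → ℝ≥0 → Ω' → ℝ, IsWienerVector Wε P' →
        (∀ᵐ ω ∂P', ∀ r, brownianPath Λε Wε ω r =
          contrast (slopeRatio βbar₁ βbar₂) *ᵥ brownianPath Λu Wu ω r) →
        -- the FCLT for `ε_{θt} = [I_n, -D_θ] U_t`
        TendstoInDistribution
          (fun T ω => partialSumPath
            (fun t ω => contrast (slopeRatio βbar₁ βbar₂) *ᵥ U t ω) T ω) atTop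
          (fun ω => Cadlag.ofFun (brownianPath Λε Wε ω)) (fun _ => P) P' ∧
        -- Case 1: large to small slopes
        (∀ κ : ℝ, 0 ≤ κ → κ < 3 / 2 →
          TendstoInDistribution
            (fun (T : ℕ) ω => (T : ℝ) ^ (3 / 2 - κ) • ivError μ₁ μ₂ βbar₁ βbar₂ κ U T ω) atTop
            (fun ω => ((1 / 12 : ℝ) • Matrix.diagonal βbar₂)⁻¹ *ᵥ
              (Λε *ᵥ demeanedTrendIntegral (brownianPath 1 Wε ω)))
            (fun _ => P) P') ∧
        HasLaw
          (fun ω => WithLp.toLp 2 (((1 / 12 : ℝ) • Matrix.diagonal βbar₂)⁻¹ *ᵥ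
            (Λε *ᵥ demeanedTrendIntegral (brownianPath 1 Wε ω))))
          (multivariateGaussian 0 ((12 : ℝ) • ((Matrix.diagonal βbar₂)⁻¹ *
            errorVariance (slopeRatio βbar₁ βbar₂) Λu * (Matrix.diagonal βbar₂)⁻¹))) P' ∧
        -- Case 2: very small slopes
        TendstoInDistribution
          (fun T ω => ivError μ₁ μ₂ βbar₁ βbar₂ (3 / 2) U T ω) atTop
          (fun ω => ((1 / 12 : ℝ) • Matrix.diagonal βbar₂ + Matrix.diagonal
              (fun i => demeanedTrendIntegral (brownianPath Λu Wu ω) (Sum.inr i)))⁻¹ *ᵥ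
            (Λε *ᵥ demeanedTrendIntegral (brownianPath 1 Wε ω)))
          (fun _ => P) P' ∧
        -- whose limit is nondegenerate, so that the estimator is inconsistent
        (∀ i, errorVariance (slopeRatio βbar₁ βbar₂) Λu i i ≠ 0 →
          (¬ ∃ c : ℝ, ∀ᵐ ω ∂P',
            (((1 / 12 : ℝ) • Matrix.diagonal βbar₂ + Matrix.diagonal
                (fun j => demeanedTrendIntegral (brownianPath Λu Wu ω) (Sum.inr j)))⁻¹ *ᵥ
              (Λε *ᵥ demeanedTrendIntegral (brownianPath 1 Wε ω))) i = c) ∧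
          ¬ TendstoInMeasure P
            (fun T ω => ivError μ₁ μ₂ βbar₁ βbar₂ (3 / 2) U T ω i) atTop (fun _ => 0))) ∧
    -- Case 3: zero slopes
    ((∀ i, (Λu * Λuᵀ) (Sum.inr i) (Sum.inr i) ≠ 0) →
      TendstoInDistribution
        (fun T ω => thetaHat μ₁ μ₂ 0 0 U T ω) atTop
        (fun ω => (Matrix.diagonal
            (fun i => demeanedTrendIntegral (brownianPath Λu Wu ω) (Sum.inr i)))⁻¹ *ᵥ
          fun i => demeanedTrendIntegral (brownianPath Λu Wu ω) (Sum.inl i))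
        (fun _ => P) P') := by
  refine ⟨fun βbar₁ βbar₂ hβ Λε hΛε => ⟨?_, fun Wε hWε hpath => ?_⟩, fun hvar => ?_⟩
  · rw [errorVariance_eq] at hΛε
    -- The witness is `W_ε = Q W_u`, which lives on the same space as `W_u` and satisfies the
    -- identity for every outcome, even if `Λ_ε` is singular.
    obtain ⟨Q, hQ, hA⟩ := Matrix.exists_rows_orthonormal_mul_eq _ Λε hΛε
    refine ⟨_, hWu.rotate hQ, ae_of_all _ fun ω r => ?_⟩
    simp only [brownianPath]
    rw [Matrix.mulVec_mulVec, hA, ← Matrix.mulVec_mulVec]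
    rfl
  · set θ := slopeRatio βbar₁ βbar₂ with hθ
    have hβθ (i : Fin n) : βbar₁ i = slopeRatio βbar₁ βbar₂ i * βbar₂ i :=
      (div_mul_cancel₀ _ (hβ i)).symm
    have hcont : ∀ᵐ ω ∂P', Continuous (brownianPath Λu Wu ω) :=
      hWu.ae_continuous_brownianPath.mono fun ω h => h Λu
    have hint := ae_mulVec_demeanedTrendIntegral_eq hWu hWε hpath
    have hne (d : ℝ) := ae_trend_add_demeanedTrendIntegral_ne_zero (Λu := Λu) (d := d) hWu
      fun i => Or.inl (hβ i)
    have hne1 : ∀ᵐ ω ∂P', ∀ i, 1 / 12 * βbar₂ i +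
        1 * demeanedTrendIntegral (brownianPath Λu Wu ω) (Sum.inr i) ≠ 0 := hne 1
    have hdiag : (1 / 12 : ℝ) • Matrix.diagonal βbar₂ =
        Matrix.diagonal fun i => 1 / 12 * βbar₂ i := by
      rw [← Matrix.diagonal_smul]; rfl
    have hlim2 : (fun ω i => (1 / 12 * βbar₂ i +
          1 * demeanedTrendIntegral (brownianPath Λu Wu ω) (Sum.inr i))⁻¹ *
        (demeanedTrendIntegral (brownianPath Λu Wu ω) (Sum.inl i) - θ i *
          demeanedTrendIntegral (brownianPath Λu Wu ω) (Sum.inr i))) =ᵐ[P']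
        fun ω => ((1 / 12 : ℝ) • Matrix.diagonal βbar₂ + Matrix.diagonal
            (fun i => demeanedTrendIntegral (brownianPath Λu Wu ω) (Sum.inr i)))⁻¹ *ᵥ
          (Λε *ᵥ demeanedTrendIntegral (brownianPath 1 Wε ω)) := by
      refine (ae_limit_eq hne1 hint).trans (ae_of_all _ fun ω => ?_)
      simp only [hdiag, Matrix.diagonal_add, one_mul]
    have hcase2 := (tendstoInDistribution_ivError hU hWu hFCLT μ₁ μ₂ βbar₁ βbar₂ hβθ
      (κ := 3 / 2) (d := 1) (by simp) hne1).congr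
      (Y := fun T ω => ivError μ₁ μ₂ βbar₁ βbar₂ (3 / 2) U T ω)
      (fun T => ae_of_all _ fun ω => by simp) hlim2
    refine ⟨?_, fun κ _ hκ => ?_, ?_, hcase2, fun i hi => ⟨?_, fun hmeas => ?_⟩⟩
    · refine (tendstoInDistribution_partialSumPath_mulVec hFCLT hcont (contrast θ)).congr
        (fun _ => ae_eq_rfl) ?_
      filter_upwards [hpath] with ω hω
      rw [← funext hω]
    · have hd : Tendsto (fun T : ℕ => (T : ℝ) ^ (κ - 3 / 2)) atTop (𝓝 0) := by
        have := (tendsto_rpow_neg_atTop (sub_pos.2 hκ)).comp tendsto_natCast_atTop_atTop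
        simpa only [neg_sub, Function.comp_def] using this
      refine (tendstoInDistribution_ivError hU hWu hFCLT μ₁ μ₂ βbar₁ βbar₂ hβθ hd
        (hne 0)).congr (fun _ => ae_eq_rfl) ((ae_limit_eq (hne 0) hint).trans
          (ae_of_all _ fun ω => ?_))
      simp only [hdiag, zero_mul, add_zero]
    · rw [← hΛε]
      exact hasLaw_inv_diagonal_mulVec_demeanedTrendIntegral hWε hβ Λε
    · rintro ⟨c, hc⟩
      refine not_ae_eq_const_limit hWu hβ hi (c := c) ?_
      filter_upwards [hc, hlim2] with ω h1 h2
      exact (congrFun h2 i).trans h1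
    -- Consistency would force this component of the limit to be the constant `0`.
    · refine not_ae_eq_const_limit hWu hβ hi (c := 0) ?_
      have h0 := ae_eq_zero_of_tendstoInMeasure_zero hcase2 hmeas
      filter_upwards [h0, hlim2] with ω h1 h2
      exact (congrFun h2 i).trans h1
  · exact tendstoInDistribution_thetaHat_zero_slopes hU hWu hFCLT μ₁ μ₂ hvar
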